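/- **Setting.** Let $T$ be an ordered tree with $n$ nodes, let $n_i$ be the number of nodes of $T$ with $i$ children, and let $\Sigma=\{i : n_i>0\}$. Let $B,L\ge 1$ be integers. Let $e_i$ be $\log_2(n/n_i)$ (or $\log_2 n$ if $n_i=0$) rounded up to a multiple of $1/L$. For a node $x$ of an ordered tree $t$, $t_x$ denotes the subtree of $x$ and all its descendants. **Objects.** $\mathcal A$ consists of the empty tree (of size $0$) and of all ordered trees with at most $2L+1$ nodes in which every node, except perhaps the root, has its number of children in $\Sigma$, and in which at most one non-root leaf is designated as the *boundary leaf*. **Parameters.** For a non-empty $S\in\mathcal A$, $f(S)$ is the vector of the following eight numbers: $\sum_x e_{\deg x}$ over all nodes $x$ of $S$; the number $|S|$ of nodes; $|S_x|$ for the rightmost child $x$ of the root; $|S_x|$ for the child $x$ of the root on the path to the boundary leaf; the maximum of $|S_y|$ over the nodes $y$ that are not on the path from the root to the boundary leaf but whose parent is (over all children $y$ of the root if there is no boundary leaf); the degree of the root; the distance from the root to the boundary leaf; the number of nodes before the boundary leaf in preorder. A number that refers to a node that does not exist is $0$, and $f(\emptyset)=(0,\dots,0)$. **Tree decomposition with parameter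 $\lambda\ge2$.** Let $t$ be an ordered tree. A node $x$ is *heavy* if $|t_x|\ge\lambda$; a heavy node is of *type 2* if it has at least two heavy children and otherwise of *type 1*. Given a node $x$ and a list of children $y_1,\dots,y_d$ of $x$ with associated subtrees, *pack* splits the list from left to right into consecutive groups, closing a group as soon as $x$ and the trees of the group have at least $\lambda$ nodes together (the last group may stay smaller); each group gives the tree consisting of $x$ and the trees of the group. The decomposition consists of the following trees. 1. For every type 2 node $x$: the edge from $x$ to each heavy child, and the trees packed from each maximal run of consecutive light (not heavy) children $y$, with associated subtrees $t_y$. 2. For every maximal path $x_1,\dots,x_k$ of type 1 nodes (each the child of the previous one): let $x'$ be the heavy child of $x_k$, if there is one, and let $S'$ be $t_{x_1}$ without the proper descendants of $x'$. Let $i$ be maximal with $|S'_{x_i}|\ge\lambda$, or $i=1$ if there is no such index. Take the trees packed from all children $y$ of $x_i$ in $S'$, with associated subtrees $S'_y$. If $i>1$, continue in the same way with the path $x_1,\dots,x_{i-1}$ and $x'=x_i$. The boundary leaf of a tree of the decomposition is its leaf that is the root of other trees of the decomposition, if there is one; otherwise it is the boundary leaf of $t$, if that exists and lies in the tree. The *decomposition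 tree* of $t$ has a root $v_r$ and a node $v_P$ for each tree $P$ of the decomposition; $v_P$ is a child of $v_Q$ if the root of $P$ is the boundary leaf of $Q$, and a child of $v_r$ if the root of $P$ is the root of $t$; siblings are ordered by the leftmost children of the roots of their trees. **Decompose.** Let $\ell:\mathbb N\to\mathbb N$ be such that $2\le\ell(m)\le m$ for $2\le m\le 2L+1$ and such that for every non-empty $S\in\mathcal A$ the decomposition of $S$ with parameter $\ell(|S|)$ has at most $B$ trees (for instance $\ell(m)=\Theta(m/B)$ with a suitable constant). For a non-empty $S\in\mathcal A$ let $\mathrm{Decompose}(S)=(g(S),S_1,\dots,S_B)$, where $g(S)$ is the balanced parenthesis string of the decomposition tree of $S$ with parameter $\ell(|S|)$, and $S_1,S_2,\dots$ are the trees of the decomposition in the preorder of the decomposition tree, followed by empty trees. The empty tree is decomposed into the empty string and empty trees. (A one-node tree has no edge, so its decomposition has no trees.) **Join.** If $\beta$ is the balanced parenthesis string of an ordered tree $S_\beta$, then $\mathrm{Join}(\beta,S_1,\dots,S_B)$ is obtained by associating $S_i$ with the $(i+1)$-st node of $S_\beta$ in preorder and merging, for every internal node $v$ of $S_\beta$,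 the boundary leaf of the tree associated with $v$ and the roots of the trees associated with the children of $v$ (if $v$ is the root of $S_\beta$, only the latter roots). The join of the empty string is the empty tree, and if $S_\beta$ has only one node, the join is the one-node tree. **Lemma.** Let $\mathcal F=\{(g(A),f(A_1),\dots,f(A_B)) : A\in\mathcal A,\ \mathrm{Decompose}(A)=(g(A),A_1,\dots,A_B)\}$. For every $\beta$ and all $S_1,\dots,S_B\in\mathcal A$ with $(\beta,f(S_1),\dots,f(S_B))\in\mathcal F$, the tree $\mathrm{Join}(\beta,S_1,\dots,S_B)$ belongs to $\mathcal A$, and $$\mathrm{Decompose}(\mathrm{Join}(\beta,S_1,\dots,S_B))=(\beta,S_1,\dots,S_B).$$ -/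

import Mathlib

/-!
# Decomposing and joining ordered trees

Ordered trees, the tree decomposition with parameter `L`, and the resulting functions
`decompose`, `join`, `g` and `f` on trees with at most one designated boundary leaf.
-/

namespace TreeRep

/-- Ordered trees whose nodes carry labels in `α`. -/
inductive RTree (α : Type) : Type where
  | node (label : α) (children : List (RTree α)) : RTree α

namespace RTree

variable {α β : Type}

/-- The label of the root. -/
def label : RTree α → α
  | node a _ => a

/-- The list of the subtrees hanging from the children of the root, from left to right. -/
def children : RTree α → List (RTree α)
  | node _ cs => cs

mutual
/-- The subtrees `subtree(t, x)` (`x` and all its descendants), where `x` runs over all the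
nodes of `t` in preorder.  So the nodes of `t` correspond to the entries of this list. -/
def subtrees : RTree α → List (RTree α)
  | node a cs => node a cs :: subtreesList cs
/-- The concatenation of the lists `subtrees c`, for `c` in a list. -/
def subtreesList : List (RTree α) → List (RTree α)
  | [] => []
  | c :: cs => subtrees c ++ subtreesList cs
end

/-- The number of nodes. -/
def size (t : RTree α) : ℕ := t.subtrees.length

/-- The number of children of the root. -/
def degree (t : RTree α) : ℕ := t.children.length

/-- The labels of the nodes, in preorder. -/
def labels (t : RTree α) : List α := t.subtrees.map label

/-- The subtrees hanging from the non-root nodes of `t`, in preorder. -/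
def properSubtrees (t : RTree α) : List (RTree α) := subtreesList t.children

mutual
/-- Change all the labels of a tree. -/
def map (h : α → β) : RTree α → RTree β
  | node a cs => node (h a) (mapList h cs)
/-- Change all the labels of a list of trees. -/
def mapList (h : α → β) : List (RTree α) → List (RTree β)
  | [] => []
  | c :: cs => map h c :: mapList h cs
end

mutual
/-- The balanced parenthesis string of a tree (`U` opens and `D` closes). -/
def bp : RTree α → List DyckStep
  | node _ cs => DyckStep.U :: (bpList cs ++ [DyckStep.D])
/-- The concatenation of the balanced parenthesis strings of a list of trees. -/
def bpList : List (RTree α) → List DyckStep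
  | [] => []
  | c :: cs => bp c ++ bpList cs
end

mutual
/-- Relabel every node by `k` plus its (0-based) preorder rank. -/
def number (k : ℕ) : RTree α → RTree ℕ
  | node _ cs => node k (numberList (k + 1) cs)
/-- Number the nodes of a list of trees consecutively in preorder, starting from `k`. -/
def numberList (k : ℕ) : List (RTree α) → List (RTree ℕ)
  | [] => []
  | c :: cs => number k c :: numberList (k + c.size) cs
end

end RTree

/-- Ordered trees. -/
abbrev OrdTree : Type := RTree Unit

/-- Ordered trees in which some nodes are marked; the mark `true` stands for
"this is the boundary leaf". -/
abbrev MTree : Type := RTree Bool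

/-- A possibly empty marked tree; `none` is the empty tree (of size 0). -/
abbrev Obj : Type := Option MTree

open RTree

/-! ### The functions `f` and the family `𝒜` -/

/-- The tree contains a marked node. -/
def HasMark (t : MTree) : Prop := true ∈ t.labels

instance (t : MTree) : Decidable (HasMark t) := by unfold HasMark; infer_instance

/-- The nodes (as subtrees) on the path from the root to the boundary leaf, or only the root
if there is no boundary leaf. -/
def pathNodes (t : MTree) : List MTree :=
  if HasMark t then t.subtrees.filter (fun s => HasMark s) else [t]

/-- The size of the subtree of the rightmost child of the root (0 if there is none). -/
def sizeRight (t : MTree) : ℕ := (t.children.getLast?.map size).getD 0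

/-- The size of the subtree of the child of the root on the path to the boundary leaf
(0 if there is no boundary leaf). -/
def sizeBoundary (t : MTree) : ℕ := ((t.children.find? (fun c => HasMark c)).map size).getD 0

/-- The maximal size of the subtree of a node which is not on the path from the root to the
boundary leaf but whose parent is (0 if there is no such node).  Without a boundary leaf this is
the maximum over the children of the root. -/
def sizeMax (t : MTree) : ℕ :=
  (((pathNodes t).flatMap (fun s => s.children.filter (fun c => ¬ HasMark c))).map size).foldr
    max 0

/-- The distance between the root and the boundary leaf (0 if there is none). -/
def distance (t : MTree) : ℕ := (pathNodes t).length - 1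

/-- The number of nodes that precede the boundary leaf in preorder (0 if there is none). -/
def preorderBoundary (t : MTree) : ℕ := if HasMark t then t.labels.idxOf true else 0

/-- The number of nodes of `T` with `i` children. -/
def degCount (T : OrdTree) (i : ℕ) : ℕ := (T.subtrees.map degree).count i

/-- The set `Σ` of the degrees that occur in `T`. -/
def degSet (T : OrdTree) : Set ℕ := {i | 0 < degCount T i}

/-- With `n = |T|` and `nᵢ` the number of nodes of `T` of degree `i`: the number
`log₂ (n / nᵢ)`, or `log₂ n` if `nᵢ = 0`, rounded up to a multiple of `1 / L`. -/
noncomputable def er (T : OrdTree) (L i : ℕ) : ℝ :=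
  if 0 < degCount T i then (⌈Real.logb 2 ((T.size : ℝ) / (degCount T i : ℝ)) * L⌉ : ℝ) / L
  else (⌈Real.logb 2 (T.size : ℝ) * L⌉ : ℝ) / L

/-- The rounded degree entropy: the sum of `er` over the degrees of all the nodes. -/
noncomputable def entropy (T : OrdTree) (L : ℕ) (t : MTree) : ℝ :=
  (t.subtrees.map (fun s => er T L s.degree)).sum

/-- The vectors of parameters that are stored for a tree. -/
@[ext] structure Params where
  entropy : ℝ
  size : ℕ
  sizeRight : ℕ
  sizeBoundary : ℕ
  sizeMax : ℕ
  degree : ℕ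
  distance : ℕ
  preorder : ℕ

/-- The function `f`.  All the parameters of the empty tree are 0. -/
noncomputable def f (T : OrdTree) (L : ℕ) : Obj → Params
  | none => ⟨0, 0, 0, 0, 0, 0, 0, 0⟩
  | some t => ⟨entropy T L t, t.size, sizeRight t, sizeBoundary t, sizeMax t, t.degree,
      distance t, preorderBoundary t⟩

/-- The family of objects: the empty tree, and the trees with at most `2L + 1` nodes in which the
degree of every node, except perhaps the root, is in `Σ`, and in which at most one node, which has
to be a non-root leaf, is marked as the boundary leaf. -/
def family (T : OrdTree) (L : ℕ) : Set Obj :=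
  {A | ∀ t, A = some t →
    t.size ≤ 2 * L + 1 ∧
    (∀ s ∈ t.properSubtrees, s.degree ∈ degSet T) ∧
    t.labels.count true ≤ 1 ∧
    t.label = false ∧
    ∀ s ∈ t.subtrees, s.label = true → s.children = []}

/-! ### The tree decomposition

A node of `t` is heavy if its subtree has at least `L` nodes; it is of type 2 if it has at least
two heavy children, and of type 1 if it is heavy and not of type 2.

* At a type 2 node `x` the trees are: the edge from `x` to each heavy child, and the trees packed
  from each maximal run of consecutive light children.
* Let `x₁, …, x_k` be a maximal path of type 1 nodes (each the child of the previous one), and let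
  `x'` be the heavy child of `x_k`, if there is one. Let `S` be the subtree of `x₁` without the
  proper descendants of `x'`. Let `i` be the maximal index for which the subtree of `x_i` in `S`
  has at least `L` nodes, or `i = 1` if there is none. The trees are those packed from all the
  children of `x_i` in `S`, and then one continues with the path `x₁, …, x_{i-1}` and `x' = x_i`.

Trees that share the root `x` hang, from left to right, from the tree whose boundary leaf is `x`.
-/

/-- The marks of the nodes during the decomposition: `old` is the boundary leaf of the
decomposed tree, `new` is a boundary leaf created by the decomposition. -/
inductive Mark : Type where
  | plain
  | old
  | new
  deriving DecidableEq

/-- Procedure `pack`, for a node whose children have the associated subtrees given by the second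
list: split the children into consecutive groups, where a group is closed as soon as its trees and
the common root have at least `L` nodes together. The first list is the group under
construction. -/
def pack (L : ℕ) : List (RTree Mark) → List (RTree Mark) → List (List (RTree Mark))
  | cur, [] => if cur = [] then [] else [cur]
  | cur, y :: ys =>
      if L ≤ 1 + ((cur ++ [y]).map size).sum then (cur ++ [y]) :: pack L [] ys
      else pack L (cur ++ [y]) ys

/-- The tree contains a boundary leaf created by the decomposition. -/
def HasNew (t : RTree Mark) : Prop := Mark.new ∈ t.labels

instance (t : RTree Mark) : Decidable (HasNew t) := by unfold HasNew; infer_instance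

/-- Turn a tree of the decomposition into a marked tree. Its boundary leaf is the one created by
the decomposition if there is one, and otherwise the boundary leaf of the decomposed tree if that
is in it. -/
def finalize (t : RTree Mark) : MTree :=
  if HasNew t then t.map (fun m => decide (m = Mark.new))
  else t.map (fun m => decide (m = Mark.old))

/-- Trees whose nodes are associated with (possibly empty) marked trees. -/
abbrev DTree : Type := RTree Obj

/-- The trees rooted at a node, packed from the trees associated with the given children, with
everything that hangs from them: `hang` hangs from the tree with the new boundary leaf. -/
def packed (L : ℕ) (ys : List (RTree Mark)) (hang : List DTree) : List DTree :=
  (pack L [] ys).map (fun grp =>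
    let p := RTree.node Mark.plain grp
    RTree.node (some (finalize p)) (if HasNew p then hang else []))

/-- The result of the decomposition below a node `x`.  `tree` is the subtree of `x` cut off at
the next root `x'` of a tree of the decomposition: `x'` is a leaf marked `new` (it may be `x`
itself), and all the trees rooted at `x'` or below are in `hang`. -/
structure Branch where
  heavy : Bool
  tree : RTree Mark
  hang : List DTree

/-- Make the node the root of the trees of the decomposition packed from its children, unless it is
a root of trees of the decomposition already. -/
def Branch.cut (L : ℕ) (r : Branch) : List DTree :=
  if r.tree.label = Mark.new then r.hang else packed L r.tree.children r.hang

/-- The trees at a type 2 heavy node whose children are given by the second list. The first list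
is the current run of light children. -/
def typeTwo (L : ℕ) : List (RTree Mark) → List Branch → List DTree
  | run, [] => packed L run []
  | run, r :: rs =>
      if r.heavy then
        packed L run [] ++
          RTree.node (some (RTree.node false [RTree.node true []])) (r.cut L) :: typeTwo L [] rs
      else typeTwo L (run ++ [r.tree]) rs

mutual
/-- The decomposition, from the leaves to the root. As the size of the part of the subtree of
`x_i` that is in `S` decreases along the path `x₁, …, x_k`, the maximal `i` for which it is at
least `L` is the first one found on the way from `x_k` up to `x₁`. -/
def walk (L : ℕ) : MTree → Branch
  | RTree.node m cs =>
      if (RTree.node m cs).size < L then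
        ⟨false, (RTree.node m cs).map (fun b => if b then Mark.old else Mark.plain), []⟩
      else
        let rs := walkList L cs
        if 2 ≤ rs.countP (fun r => r.heavy) then
          ⟨true, RTree.node Mark.new [], typeTwo L [] rs⟩
        else
          let r : Branch :=
            ⟨true, RTree.node Mark.plain (rs.map Branch.tree), rs.flatMap Branch.hang⟩
          if L ≤ r.tree.size then ⟨true, RTree.node Mark.new [], r.cut L⟩ else r
/-- The decomposition below each node of a list. -/
def walkList (L : ℕ) : List MTree → List Branch
  | [] => []
  | c :: cs => walk L c :: walkList L cs
end

/-- The tree of the decomposition of `t` with parameter `L`: every non-root node is associated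
with a tree of the decomposition, and is the child of the tree whose boundary leaf is its root;
the trees that contain the root of `t` are the children of an additional root. -/
def decompTree (L : ℕ) (t : MTree) : DTree := RTree.node none ((walk L t).cut L)

/-- The trees of the decomposition, numbered in preorder of the decomposition tree. -/
def pieces (L : ℕ) (t : MTree) : List Obj := (decompTree L t).labels.tail

/-- `Decompose`, when the tree `t` is decomposed with parameter `ℓ |t|`: the balanced parenthesis
string of the decomposition tree, and the trees of the decomposition, padded with empty trees. -/
def decompose (B : ℕ) (ℓ : ℕ → ℕ) : Obj → List DyckStep × (Fin B → Obj)
  | none => ([], fun _ => none)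
  | some t => ((decompTree (ℓ t.size) t).bp, fun i => (pieces (ℓ t.size) t).getD i none)

/-- The set `𝓕` of all the tuples `(g(A), f(A₁), …, f(A_B))`, where `A` is in the family
and `Decompose(A) = (g(A), A₁, …, A_B)`. -/
def tuples (T : OrdTree) (B L : ℕ) (ℓ : ℕ → ℕ) : Set (List DyckStep × (Fin B → Params)) :=
  {x | ∃ A ∈ family T L,
    x = ((decompose B ℓ A).1, fun i => f T L ((decompose B ℓ A).2 i))}

/-! ### Joining -/

mutual
/-- Merge the marked leaf of a tree with the common root of the trees `kids`. -/
def graft (kids : List MTree) : MTree → MTree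
  | RTree.node m cs => if m then RTree.node false kids else RTree.node m (graftList kids cs)
/-- Merge the marked leaves of a list of trees with the common root of the trees `kids`. -/
def graftList (kids : List MTree) : List MTree → List MTree
  | [] => []
  | c :: cs => graft kids c :: graftList kids cs
end

mutual
/-- Merge all the trees `S j` associated with the nodes of a numbered tree: at every internal
node, the boundary leaf of its tree and the roots of the trees of its children are merged.
The output is the list of the subtrees of the children of the root of the merged tree. -/
def glue (S : ℕ → Obj) : RTree ℕ → List MTree
  | RTree.node j ds =>
      match S j with
      | none => []
      | some p => if ds = [] then p.children else graftList (glueList S ds) p.children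
/-- Merge the roots of the trees given by a list of numbered trees. -/
def glueList (S : ℕ → Obj) : List (RTree ℕ) → List MTree
  | [] => []
  | d :: ds => glue S d ++ glueList S ds
end

open Classical in
/-- `Join`. If `b` is the balanced parenthesis string of a tree, then `S 0, S 1, …` are associated
with its non-root nodes in preorder and merged; the roots of the trees associated with the children
of the root are merged, too. The join of the empty string is the empty tree. -/
noncomputable def join {B : ℕ} (b : List DyckStep) (S : Fin B → Obj) : Obj :=
  if h : ∃ t : OrdTree, t.bp = b then
    some (RTree.node false
      (glueList (fun j => if hj : j < B then S ⟨j, hj⟩ else none)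
        (numberList 0 h.choose.children)))
  else none

mutual
/-- A balanced parenthesis string determines its tree. -/
theorem bp_append_inj : ∀ (s t : OrdTree) (u v : List DyckStep),
    s.bp ++ u = t.bp ++ v → s = t ∧ u = v
  | RTree.node _ cs, RTree.node _ ds, u, v, h => by
      simp only [bp, List.cons_append, List.append_assoc, List.cons.injEq, true_and,
        List.nil_append] at h
      obtain ⟨h1, h2⟩ := bpList_append_inj cs ds u v h
      exact ⟨by rw [h1], h2⟩
/-- The version of `bp_append_inj` for lists of trees. -/
theorem bpList_append_inj : ∀ (cs ds : List OrdTree) (u v : List DyckStep),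
    bpList cs ++ DyckStep.D :: u = bpList ds ++ DyckStep.D :: v → cs = ds ∧ u = v
  | [], [], u, v, h => by simpa [bpList] using h
  | [], RTree.node _ _ :: _, u, v, h => by simp [bpList, bp] at h
  | RTree.node _ _ :: _, [], u, v, h => by simp [bpList, bp] at h
  | c :: cs, d :: ds, u, v, h => by
      simp only [bpList, List.append_assoc] at h
      obtain ⟨h1, h2⟩ := bp_append_inj c d _ _ h
      obtain ⟨h3, h4⟩ := bpList_append_inj cs ds u v h2
      exact ⟨by rw [h1, h3], h4⟩
end

/-- The tree chosen in the definition of `join` is unique. -/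
theorem bp_injective : Function.Injective (bp : OrdTree → List DyckStep) :=
  fun s t h => (bp_append_inj s t [] [] (by rw [h])).1

end TreeRep

/-!
Let `A` be a tree of the family and `K` the parameter with which it is decomposed. If the trees of
the decomposition of `A` are exchanged for trees of the family with the same parameters, the walk
that decomposes the joined tree makes the same choices as the walk that decomposes `A`:

* The subtree of a node at which pieces are rooted keeps its size, so such a node stays heavy.
* The subtrees of a packed piece at the children of its root have fewer than `K` nodes. This can be
  read off `sizeMax` and `sizeBoundary` (`params_of_f_eq`). Hence in the new tree everything off the
  path to the boundary leaf is light, and the nodes strictly between the root and a new boundary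
  leaf have exactly one heavy child and are not cut (`walk_graft`).
* When `pack` closes a group depends only on the size of the piece and of its rightmost branch
  (`sizeRight`), so the new groups are packed in the same way (`IsPacking.of_forall₂`).
* The preorder rank of the boundary leaf is positive exactly if there is a boundary leaf. A piece
  that is a single edge is determined by its parameters (`eq_edge`).

So the proof is an induction on `A`. At a heavy node `x` with the forest `D` of the pieces rooted at
`x` or below, the induction shows `Rebuilds`: for every forest `D'` that is similar to `D` (`Sim`),
the decomposition of the join of `D'` is `D'`. If the walk cuts at `x`, the stronger property
`Cutable` holds: the walk in the join cuts at the root, too. Otherwise `x` is an inner node of a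
piece or a root by default, and what has to be passed on to the parent of `x` is `Cutable` for the
forest that hangs from the new boundary leaf below `x`. Both properties include the numbers of
nodes, marks and children (`Counts`), which show in the end that the join is a member of the family
and is decomposed with the same parameter `K`. The step of the induction is `node_spec`; it rests on
`packed_spec` for the pieces packed from the children of a node and on `typeTwo_spec` for nodes with
two or more heavy children.

The decomposition forgets a boundary leaf of `A` that lies in a piece with a new boundary leaf. The
join then has fewer marks than `A`, which is why `Counts` only bounds the number of marks.
-/

namespace TreeRep
open RTree

/-! ### Ordered trees and forests -/

namespace RTree

variable {α β γ : Type}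

/-- Induction on trees, where the induction hypothesis is about the members of the list of
children. -/
theorem induct {motive : RTree α → Prop}
    (h : ∀ a cs, (∀ c ∈ cs, motive c) → motive (node a cs)) (t : RTree α) : motive t :=
  RTree.rec (motive_1 := motive) (motive_2 := fun cs => ∀ c ∈ cs, motive c)
    (fun a cs ih => h a cs ih) (by simp)
    (fun c cs hc hcs => by simpa using ⟨hc, hcs⟩) t

/-- The labels of the nodes of a forest, in preorder. -/
def labelsList (cs : List (RTree α)) : List α := (subtreesList cs).map label

@[simp] theorem subtreesList_append (cs ds : List (RTree α)) :
    subtreesList (cs ++ ds) = subtreesList cs ++ subtreesList ds := by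
  induction cs with
  | nil => simp [subtreesList]
  | cons c cs ih => simp [subtreesList, ih]

theorem mem_subtreesList {s : RTree α} {cs : List (RTree α)} :
    s ∈ subtreesList cs ↔ ∃ c ∈ cs, s ∈ c.subtrees := by
  induction cs with
  | nil => simp [subtreesList]
  | cons c cs ih => simp [subtreesList, ih]

theorem length_subtreesList (cs : List (RTree α)) :
    (subtreesList cs).length = (cs.map size).sum := by
  induction cs with
  | nil => simp [subtreesList]
  | cons c cs ih => simp [subtreesList, ih, size]

@[simp] theorem size_node (a : α) (cs : List (RTree α)) :
    (node a cs).size = 1 + (cs.map size).sum := by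
  rw [size, subtrees, List.length_cons, length_subtreesList, Nat.add_comm]

theorem size_pos (t : RTree α) : 0 < t.size := by
  cases t; simp

@[simp] theorem labels_node (a : α) (cs : List (RTree α)) :
    (node a cs).labels = a :: labelsList cs := by
  simp [labels, subtrees, labelsList, label]

@[simp] theorem labelsList_nil : labelsList ([] : List (RTree α)) = [] := rfl

@[simp] theorem labelsList_cons (c : RTree α) (cs : List (RTree α)) :
    labelsList (c :: cs) = c.labels ++ labelsList cs := by
  simp [labelsList, subtreesList, labels]

@[simp] theorem labelsList_append (cs ds : List (RTree α)) :
    labelsList (cs ++ ds) = labelsList cs ++ labelsList ds := by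
  simp [labelsList]

theorem mem_labelsList {a : α} {cs : List (RTree α)} :
    a ∈ labelsList cs ↔ ∃ c ∈ cs, a ∈ c.labels := by
  induction cs with
  | nil => simp
  | cons c cs ih => simp [ih]

theorem mapList_eq (h : α → β) (cs : List (RTree α)) : mapList h cs = cs.map (map h) := by
  induction cs with
  | nil => simp [mapList]
  | cons c cs ih => simp [mapList, ih]

@[simp] theorem map_node (h : α → β) (a : α) (cs : List (RTree α)) :
    (node a cs).map h = node (h a) (cs.map (map h)) := by
  rw [map, mapList_eq]

theorem labels_map (h : α → β) (t : RTree α) : (t.map h).labels = t.labels.map h := by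
  induction t using induct with
  | h a cs ih =>
    simp only [map_node, labels_node, List.map_cons, List.cons.injEq, true_and]
    induction cs with
    | nil => simp
    | cons c cs ih' =>
      simp only [List.map_cons, labelsList_cons, List.map_append]
      rw [ih c (by simp), ih' (fun c hc => ih c (by simp [hc]))]

@[simp] theorem labelsList_map (h : α → β) (cs : List (RTree α)) :
    labelsList (cs.map (map h)) = (labelsList cs).map h := by
  induction cs with
  | nil => simp
  | cons c cs ih => simp [ih, labels_map]

theorem length_labels (t : RTree α) : t.labels.length = t.size := by
  simp [labels, size]

@[simp] theorem size_map (h : α → β) (t : RTree α) : (t.map h).size = t.size := by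
  rw [← length_labels, labels_map, List.length_map, length_labels]

theorem map_map (h : α → β) (k : β → γ) (t : RTree α) :
    (t.map h).map k = t.map (fun a => k (h a)) := by
  induction t using induct with
  | h a cs ih => simpa using ih

theorem map_congr {h k : α → β} {t : RTree α} (e : ∀ a ∈ t.labels, h a = k a) :
    t.map h = t.map k := by
  induction t using induct with
  | h a cs ih =>
    simp only [labels_node, List.mem_cons, forall_eq_or_imp, mem_labelsList] at e
    simp only [map_node, node.injEq, e.1, true_and, List.map_inj_left]
    exact fun c hc => ih c hc fun a ha => e.2 a ⟨c, hc, ha⟩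

theorem map_id_of {h : α → α} {t : RTree α} (e : ∀ a ∈ t.labels, h a = a) : t.map h = t := by
  induction t using induct with
  | h a cs ih =>
    simp only [labels_node, List.mem_cons, forall_eq_or_imp, mem_labelsList] at e
    simp only [map_node, node.injEq, e.1, true_and]
    conv_rhs => rw [← List.map_id cs]
    rw [List.map_inj_left]
    exact fun c hc => ih c hc fun a ha => e.2 a ⟨c, hc, ha⟩

theorem bpList_eq (cs : List (RTree α)) : bpList cs = cs.flatMap bp := by
  induction cs with
  | nil => simp [bpList]
  | cons c cs ih => simp [bpList, ih]

theorem bp_map (h : α → β) (t : RTree α) : (t.map h).bp = t.bp := by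
  induction t using induct with
  | h a cs ih =>
    simp only [map_node, bp, bpList_eq, List.flatMap_map]
    congr 2
    exact List.flatMap_congr ih

theorem self_mem_subtrees (t : RTree α) : t ∈ t.subtrees := by
  cases t; simp [subtrees]

theorem size_le_of_mem_subtrees {s t : RTree α} (h : s ∈ t.subtrees) : s.size ≤ t.size := by
  induction t using induct with
  | h a cs ih =>
    simp only [subtrees, List.mem_cons, mem_subtreesList] at h
    rcases h with rfl | ⟨c, hc, hs⟩
    · exact le_rfl
    · have h1 := ih c hc hs
      have h2 : c.size ≤ (cs.map size).sum := List.le_sum_of_mem (List.mem_map_of_mem hc)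
      rw [size_node]; omega

theorem size_le_sum {c : RTree α} {cs : List (RTree α)} (h : c ∈ cs) :
    c.size ≤ (cs.map size).sum := List.le_sum_of_mem (List.mem_map_of_mem h)

theorem children_mem_subtrees {s t c : RTree α} (h : s ∈ t.subtrees) (hc : c ∈ s.children) :
    c ∈ t.properSubtrees := by
  induction t using induct with
  | h a cs ih =>
    simp only [subtrees, List.mem_cons, mem_subtreesList] at h
    simp only [properSubtrees, children, mem_subtreesList]
    rcases h with rfl | ⟨c', hc', hs⟩
    · exact ⟨c, hc, self_mem_subtrees c⟩
    · refine ⟨c', hc', ?_⟩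
      have := ih c' hc' hs
      cases c'
      rw [subtrees]
      exact List.mem_cons_of_mem _ this

theorem map_numberList_of {δ : Type} {F : ℕ → δ} {h : α → δ} {cs : List (RTree α)}
    (ih : ∀ c ∈ cs, ∀ k, (∀ i (hi : i < c.labels.length), F (k + i) = h (c.labels[i])) →
      (c.number k).map F = c.map h) (k : ℕ)
    (e : ∀ i (hi : i < (labelsList cs).length), F (k + i) = h ((labelsList cs)[i])) :
    (numberList k cs).map (map F) = cs.map (map h) := by
  induction cs generalizing k with
  | nil => simp [numberList]
  | cons c cs ih' =>
    simp only [numberList, List.map_cons, List.cons.injEq]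
    constructor
    · refine ih c (by simp) k fun i hi => ?_
      rw [e i (by simp; omega)]
      simp [List.getElem_append_left hi]
    · refine ih' (fun c hc => ih c (by simp [hc])) (k + c.size) fun i hi => ?_
      have := e (c.size + i) (by simp [length_labels]; omega)
      rw [Nat.add_assoc, this]
      simp [List.getElem_append_right, length_labels]

/-- Numbering a tree in preorder and replacing every number by a value depending on it is a map of
the labels, if the values are those that the map gives to the labels in preorder. -/
theorem map_number {δ : Type} (F : ℕ → δ) (h : α → δ) (t : RTree α) (k : ℕ)
    (e : ∀ i (hi : i < t.labels.length), F (k + i) = h (t.labels[i])) :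
    (t.number k).map F = t.map h := by
  induction t using induct generalizing k with
  | h a cs ih =>
    simp only [number, map_node, node.injEq]
    refine ⟨by simpa using e 0 (by simp), map_numberList_of ih _ fun i hi => ?_⟩
    have := e (i + 1) (by simpa using hi)
    simpa [Nat.add_comm, Nat.add_left_comm] using this

theorem map_numberList {δ : Type} (F : ℕ → δ) (h : α → δ) (cs : List (RTree α)) (k : ℕ)
    (e : ∀ i (hi : i < (labelsList cs).length), F (k + i) = h ((labelsList cs)[i])) :
    (numberList k cs).map (map F) = cs.map (map h) :=
  map_numberList_of (fun c _ => map_number F h c) k e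

theorem labelsList_numberList_of {cs : List (RTree α)}
    (ih : ∀ c ∈ cs, ∀ k, (c.number k).labels = List.range' k c.size) (k : ℕ) :
    labelsList (numberList k cs) = List.range' k (cs.map size).sum := by
  induction cs generalizing k with
  | nil => simp [numberList]
  | cons c cs ih' =>
    simp only [numberList, labelsList_cons, List.map_cons, List.sum_cons]
    rw [ih c (by simp), ih' (fun c hc => ih c (by simp [hc]))]
    exact List.range'_append_1 ..

theorem labels_number (t : RTree α) (k : ℕ) : (t.number k).labels = List.range' k t.size := by
  induction t using induct generalizing k with
  | h a cs ih =>
    simp only [number, labels_node, size_node, labelsList_numberList_of ih]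
    rw [Nat.add_comm 1 (List.map size cs).sum, List.range'_succ]

theorem labelsList_numberList (cs : List (RTree α)) (k : ℕ) :
    labelsList (numberList k cs) = List.range' k (cs.map size).sum :=
  labelsList_numberList_of (fun c _ => labels_number c) k

theorem numberList_map_of {h : α → β} {cs : List (RTree α)}
    (ih : ∀ c ∈ cs, ∀ k, (c.map h).number k = c.number k) (k : ℕ) :
    numberList k (cs.map (map h)) = numberList k cs := by
  induction cs generalizing k with
  | nil => rfl
  | cons c cs ih' =>
    simp only [numberList, List.map_cons, size_map, List.cons.injEq]
    exact ⟨ih c (by simp) k, ih' (fun c hc => ih c (by simp [hc])) _⟩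

theorem number_map (h : α → β) (t : RTree α) (k : ℕ) : (t.map h).number k = t.number k := by
  induction t using induct generalizing k with
  | h a cs ih => simp only [number, map_node, numberList_map_of ih]

theorem numberList_map (h : α → β) (cs : List (RTree α)) (k : ℕ) :
    numberList k (cs.map (map h)) = numberList k cs :=
  numberList_map_of (fun c _ => number_map h c) k

end RTree

/-! ### Parameters of a marked tree -/

theorem foldr_max_lt {l : List ℕ} {K : ℕ} (hK : 0 < K) :
    l.foldr max 0 < K ↔ ∀ x ∈ l, x < K := by
  induction l with
  | nil => simpa using hK
  | cons a l ih => simp [ih]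

theorem hasMark_iff_count (t : MTree) : HasMark t ↔ 0 < t.labels.count true :=
  List.count_pos_iff.symm

theorem hasMark_iff_preorder {t : MTree} (h : t.label = false) :
    HasMark t ↔ preorderBoundary t ≠ 0 := by
  obtain ⟨a, cs⟩ := t
  cases h
  unfold preorderBoundary
  split_ifs with hm
  · simp [hm]
  · simp [hm]

/-- As there is at most one mark, a marked child is the child that `sizeBoundary` refers to. -/
theorem find?_hasMark {cs : List MTree} (h : (labelsList cs).count true ≤ 1) {c : MTree}
    (hc : c ∈ cs) (hm : HasMark c) : cs.find? (fun c => HasMark c) = some c := by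
  induction cs with
  | nil => simp at hc
  | cons x xs ih =>
    rw [labelsList_cons, List.count_append] at h
    rw [hasMark_iff_count] at hm
    by_cases hx : HasMark x
    · rw [List.find?_cons_of_pos (by simpa using hx)]
      rw [hasMark_iff_count] at hx
      rcases List.mem_cons.1 hc with rfl | hc
      · rfl
      · have : 0 < (labelsList xs).count true := List.count_pos_iff.2
          (mem_labelsList.2 ⟨c, hc, List.count_pos_iff.1 hm⟩)
        omega
    · rw [List.find?_cons_of_neg (by simpa using hx)]
      rcases List.mem_cons.1 hc with rfl | hc
      · exact absurd ((hasMark_iff_count _).2 hm) hx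
      · exact ih (by omega) hc

theorem self_mem_pathNodes (t : MTree) : t ∈ pathNodes t := by
  unfold pathNodes
  split_ifs with h
  · simp [h, self_mem_subtrees]
  · simp

theorem mem_subtrees_of_mem_pathNodes {s t : MTree} (h : s ∈ pathNodes t) : s ∈ t.subtrees := by
  unfold pathNodes at h
  split_ifs at h
  · exact (List.mem_filter.1 h).1
  · rw [List.mem_singleton.1 h]; exact self_mem_subtrees t

/-- The two size parameters `sizeMax` and `sizeBoundary` together bound the subtrees of all the
children of the root. -/
theorem children_size_lt {q : MTree} {K : ℕ} (hK : 0 < K) (hq : q.labels.count true ≤ 1)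
    (h1 : sizeMax q < K) (h2 : sizeBoundary q < K) : ∀ c ∈ q.children, c.size < K := by
  intro c hc
  by_cases hm : HasMark c
  · have : q.children.find? (fun c => HasMark c) = some c := by
      refine find?_hasMark ?_ hc hm
      obtain ⟨a, cs⟩ := q
      rw [labels_node, List.count_cons] at hq
      simp only [children]
      omega
    simpa [sizeBoundary, this] using h2
  · refine (foldr_max_lt hK).1 h1 _ (List.mem_map_of_mem (List.mem_flatMap.2
      ⟨q, self_mem_pathNodes q, ?_⟩))
    simp [hc, hm]

theorem sizeMax_lt {q : MTree} {K : ℕ} (hK : 0 < K) (h : ∀ c ∈ q.children, c.size < K) :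
    sizeMax q < K := by
  refine (foldr_max_lt hK).2 fun x hx => ?_
  simp only [List.mem_map, List.mem_flatMap, List.mem_filter] at hx
  obtain ⟨c, ⟨s, hs, hc, -⟩, rfl⟩ := hx
  have := children_mem_subtrees (mem_subtrees_of_mem_pathNodes hs) hc
  obtain ⟨d, hd, hcd⟩ := mem_subtreesList.1 this
  exact (size_le_of_mem_subtrees hcd).trans_lt (h d hd)

theorem sizeBoundary_lt {q : MTree} {K : ℕ} (hK : 0 < K) (h : ∀ c ∈ q.children, c.size < K) :
    sizeBoundary q < K := by
  unfold sizeBoundary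
  cases e : q.children.find? (fun c => HasMark c) with
  | none => simpa using hK
  | some c => simpa using h c (List.mem_of_find?_eq_some e)

/-! ### Grafting and joining -/

theorem graftList_eq (kids cs : List MTree) : graftList kids cs = cs.map (graft kids) := by
  induction cs with
  | nil => simp [graftList]
  | cons c cs ih => simp [graftList, ih]

/-- The marked nodes of the tree are leaves. -/
def MarksAreLeaves (t : MTree) : Prop := ∀ s ∈ t.subtrees, s.label = true → s.children = []

theorem marksAreLeaves_node {a : Bool} {cs : List MTree} :
    MarksAreLeaves (node a cs) ↔ (a = true → cs = []) ∧ ∀ c ∈ cs, MarksAreLeaves c := by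
  simp only [MarksAreLeaves, subtrees, List.mem_cons, forall_eq_or_imp, label, children,
    mem_subtreesList]
  exact and_congr_right fun _ => ⟨fun h c hc s hs => h s ⟨c, hc, hs⟩,
    fun h s ⟨c, hc, hs⟩ => h c hc s hs⟩

theorem sum_size_graft {kids cs : List MTree}
    (h : ∀ c ∈ cs, (graft kids c).size = c.size + c.labels.count true * (kids.map size).sum) :
    ((cs.map (graft kids)).map size).sum
      = (cs.map size).sum + (labelsList cs).count true * (kids.map size).sum := by
  induction cs with
  | nil => simp
  | cons c cs ih =>
    have h1 := h c (by simp)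
    have h2 := ih fun c hc => h c (by simp [hc])
    simp only [List.map_cons, List.sum_cons, labelsList_cons, List.count_append, h1, h2]
    ring

theorem size_graft (kids : List MTree) {c : MTree} (hc : MarksAreLeaves c) :
    (graft kids c).size = c.size + c.labels.count true * (kids.map size).sum := by
  induction c using induct with
  | h a cs ih =>
    rw [marksAreLeaves_node] at hc
    cases a with
    | true => rw [hc.1 rfl]; simp [graft]
    | false =>
      simp [graft, graftList_eq, -List.map_map, sum_size_graft fun c h => ih c h (hc.2 c h)]
      ring

theorem count_labelsList_graft {kids cs : List MTree}
    (h : ∀ c ∈ cs, (graft kids c).labels.count true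
      = c.labels.count true * (labelsList kids).count true) :
    (labelsList (cs.map (graft kids))).count true
      = (labelsList cs).count true * (labelsList kids).count true := by
  induction cs with
  | nil => simp
  | cons c cs ih =>
    have h1 := h c (by simp)
    have h2 := ih fun c hc => h c (by simp [hc])
    simp only [List.map_cons, labelsList_cons, List.count_append, h1, h2]
    ring

theorem count_graft (kids : List MTree) {c : MTree} (hc : MarksAreLeaves c) :
    (graft kids c).labels.count true = c.labels.count true * (labelsList kids).count true := by
  induction c using induct with
  | h a cs ih =>
    rw [marksAreLeaves_node] at hc
    cases a with
    | true => rw [hc.1 rfl]; simp [graft]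
    | false =>
      simp [graft, graftList_eq, count_labelsList_graft fun c h => ih c h (hc.2 c h)]

/-- A property of nodes that depends only on the mark and the number of children of the node
survives grafting. -/
theorem forall_subtrees_graft {P : Bool → ℕ → Prop} {kids : List MTree} {c : MTree}
    (hc : ∀ s ∈ c.subtrees, P s.label s.degree) (h0 : P false kids.length)
    (hk : ∀ s ∈ subtreesList kids, P s.label s.degree) :
    ∀ s ∈ (graft kids c).subtrees, P s.label s.degree := by
  induction c using induct with
  | h a cs ih =>
    cases a with
    | true => simpa [graft, subtrees, label, degree, children] using ⟨h0, hk⟩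
    | false =>
      simp only [subtrees, List.mem_cons, forall_eq_or_imp, label, degree, children,
        mem_subtreesList] at hc
      simp only [graft, graftList_eq, Bool.false_eq_true, if_false, subtrees, List.mem_cons,
        forall_eq_or_imp, label, degree, children, mem_subtreesList, List.length_map, List.mem_map]
      refine ⟨hc.1, ?_⟩
      rintro s ⟨_, ⟨c, h, rfl⟩, hs⟩
      exact ih c h (fun s hs => hc.2 s ⟨c, h, hs⟩) s hs

mutual
/-- The children of the root of the tree obtained by merging the marked trees of a decomposition
tree: `glue` for nodes that carry their trees themselves. -/
def glueTree : DTree → List MTree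
  | node o ds =>
      match o with
      | none => []
      | some p => if ds = [] then p.children else graftList (glueForest ds) p.children
/-- The merged trees of a forest whose trees share their root. -/
def glueForest : List DTree → List MTree
  | [] => []
  | d :: ds => glueTree d ++ glueForest ds
end

theorem glueForest_append (D E : List DTree) :
    glueForest (D ++ E) = glueForest D ++ glueForest E := by
  induction D with
  | nil => simp [glueForest]
  | cons d D ih => simp [glueForest, ih]

theorem glue_eq_glueTree (S : ℕ → Obj) (t : RTree ℕ) : glue S t = glueTree (t.map S) := by
  induction t using induct with
  | h j ds ih =>
    have : glueList S ds = glueForest (ds.map (RTree.map S)) := by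
      induction ds with
      | nil => rfl
      | cons d ds ih' =>
        simp only [glueList, List.map_cons, glueForest]
        rw [ih d (by simp), ih' fun d h => ih d (by simp [h])]
    cases e : S j <;> simp [glue, glueTree, e, this]

theorem glueList_eq_glueForest (S : ℕ → Obj) (ds : List (RTree ℕ)) :
    glueList S ds = glueForest (ds.map (RTree.map S)) := by
  induction ds with
  | nil => rfl
  | cons d ds ih => simp only [glueList, List.map_cons, glueForest, ih, glue_eq_glueTree]

/-! ### Packing -/

/-- The groups that packing produces: they are non-empty, they have not been closed before their
last tree, and all but the last one have been closed. -/
def IsPacking (K : ℕ) : List (List (RTree Mark)) → Prop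
  | [] => True
  | g :: gs => g ≠ [] ∧ 1 + (g.dropLast.map size).sum < K ∧
      (gs ≠ [] → K ≤ 1 + (g.map size).sum) ∧ IsPacking K gs

/-- The result of `pack` is a packing of the given list. Conversely, every packing is a result of
`pack` by `IsPacking.pack_flatten`. -/
theorem pack_spec {K : ℕ} (hK : 2 ≤ K) (ys cur : List (RTree Mark))
    (h : 1 + (cur.map size).sum < K) :
    (pack K cur ys).flatten = cur ++ ys ∧ IsPacking K (pack K cur ys) := by
  induction ys generalizing cur with
  | nil =>
    unfold pack
    split_ifs with hc
    · simp [hc, IsPacking]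
    · refine ⟨by simp, hc, lt_of_le_of_lt ?_ h, by simp, trivial⟩
      conv_rhs => rw [← List.dropLast_append_getLast hc]
      simp
  | cons y ys ih =>
    unfold pack
    split_ifs with hc
    · obtain ⟨h1, h2⟩ := ih [] (by simp; omega)
      exact ⟨by simp [h1], by simp, by simpa using h, fun _ => hc, h2⟩
    · obtain ⟨h1, h2⟩ := ih (cur ++ [y]) (by omega)
      exact ⟨by simp [h1], h2⟩

theorem pack_open {K : ℕ} (xs rest cur : List (RTree Mark))
    (h : 1 + ((cur ++ xs).map size).sum < K) :
    pack K cur (xs ++ rest) = pack K (cur ++ xs) rest := by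
  induction xs generalizing cur with
  | nil => simp
  | cons x xs ih =>
    rw [List.cons_append, pack, if_neg, ih]
    · simp
    · simpa using h
    · simp only [List.map_append, List.map_cons, List.sum_append, List.sum_cons, List.map_nil,
        List.sum_nil] at h ⊢
      omega

theorem IsPacking.pack_flatten {K : ℕ} {gs : List (List (RTree Mark))} (h : IsPacking K gs) :
    pack K [] gs.flatten = gs := by
  induction gs with
  | nil => simp [pack]
  | cons g gs ih =>
    obtain ⟨h1, h2, h3, h4⟩ := h
    have e := List.dropLast_append_getLast h1
    rw [List.flatten_cons, ← e, List.append_assoc, pack_open _ _ _ (by simpa using h2)]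
    simp only [List.nil_append, List.singleton_append, pack]
    rw [e]
    by_cases hg : gs = []
    · subst hg
      split_ifs <;> simp [pack, h1]
    · rw [if_pos (h3 hg), ih h4]

/-- Packing sees only the sizes of the trees. -/
theorem IsPacking.of_forall₂ {K : ℕ} {gs gs' : List (List (RTree Mark))} (h : IsPacking K gs)
    (e : List.Forall₂ (fun g g' => g' ≠ [] ∧ (g'.map size).sum = (g.map size).sum ∧
      (g'.dropLast.map size).sum = (g.dropLast.map size).sum) gs gs') : IsPacking K gs' := by
  induction e with
  | nil => exact h
  | cons e1 e2 ih =>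
    obtain ⟨-, h2, h3, h4⟩ := h
    refine ⟨e1.1, by rw [e1.2.2]; exact h2, fun hne => ?_, ih h4⟩
    rw [e1.2.1]
    refine h3 fun h0 => ?_
    subst h0
    cases e2
    exact hne rfl

/-! ### The walk -/

/-- The label of a node in a tree whose boundary leaf is the one of the decomposed tree. -/
def oldMark (b : Bool) : Mark := if b then Mark.old else Mark.plain

/-- The label of a node in a tree whose boundary leaf was created by the decomposition. -/
def newMark (b : Bool) : Mark := if b then Mark.new else Mark.plain

theorem walkList_eq (K : ℕ) (cs : List MTree) : walkList K cs = cs.map (walk K) := by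
  induction cs with
  | nil => simp [walkList]
  | cons c cs ih => simp [walkList, ih]

theorem walk_light {K : ℕ} {t : MTree} (h : t.size < K) :
    walk K t = ⟨false, t.map oldMark, []⟩ := by
  obtain ⟨m, cs⟩ := t
  rw [walk, if_pos h]
  rfl

theorem walk_heavy {K : ℕ} {m : Bool} {cs : List MTree} (h : K ≤ (node m cs).size) :
    walk K (node m cs) =
      if 2 ≤ (cs.map (walk K)).countP (fun r => r.heavy) then
        ⟨true, node Mark.new [], typeTwo K [] (cs.map (walk K))⟩
      else if K ≤ 1 + (((cs.map (walk K)).map Branch.tree).map size).sum then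
        ⟨true, node Mark.new [],
          packed K ((cs.map (walk K)).map Branch.tree) ((cs.map (walk K)).flatMap Branch.hang)⟩
      else ⟨true, node Mark.plain ((cs.map (walk K)).map Branch.tree),
        (cs.map (walk K)).flatMap Branch.hang⟩ := by
  rw [walk, if_neg (by omega), walkList_eq]
  simp only [size_node]
  rfl

theorem heavy_walk (K : ℕ) (t : MTree) : (walk K t).heavy = decide (K ≤ t.size) := by
  by_cases h : t.size < K
  · rw [walk_light h]; simpa using h
  · obtain ⟨m, cs⟩ := t
    rw [walk_heavy (by omega)]
    rw [decide_eq_true (by omega)]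
    split_ifs <;> rfl

theorem graft_eq_self (kids : List MTree) {c : MTree} (h : c.labels.count true = 0) :
    graft kids c = c := by
  induction c using induct with
  | h a cs ih =>
    cases a with
    | true => simp at h
    | false =>
      simp only [labels_node, List.count_eq_zero, List.mem_cons, mem_labelsList, not_or,
        not_exists, not_and] at h ih
      simp only [graft, graftList_eq, Bool.false_eq_true, if_false, node.injEq, true_and]
      conv_rhs => rw [← List.map_id cs]
      rw [List.map_inj_left]
      exact fun c hc => ih c hc (h.2 c hc)

/-- The version of `walk_graft` for lists of trees, which is part of its induction. -/
theorem walk_graft_children {K : ℕ} {kids : List MTree} {H : List DTree} {cs : List MTree}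
    (ih : ∀ c ∈ cs, MarksAreLeaves c → c.size < K → c.labels.count true ≤ 1 →
      walk K (graft kids c) = ⟨decide (c.labels.count true = 1), c.map newMark,
        if c.labels.count true = 1 then H else []⟩)
    (hc : ∀ c ∈ cs, MarksAreLeaves c) (hcK : ∀ c ∈ cs, c.size < K)
    (h1 : (labelsList cs).count true ≤ 1) :
    ((cs.map (graft kids)).map (walk K)).map Branch.tree = cs.map (RTree.map newMark) ∧
      ((cs.map (graft kids)).map (walk K)).countP (fun r => r.heavy)
        = (labelsList cs).count true ∧
      ((cs.map (graft kids)).map (walk K)).flatMap Branch.hang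
        = if (labelsList cs).count true = 1 then H else [] := by
  induction cs with
  | nil => simp
  | cons c cs ih' =>
    simp only [labelsList_cons, List.count_append] at h1
    have e := ih c (by simp) (hc c (by simp)) (hcK c (by simp)) (by omega)
    obtain ⟨e1, e2, e3⟩ := ih' (fun c h => ih c (by simp [h])) (fun c h => hc c (by simp [h]))
      (fun c h => hcK c (by simp [h])) (by omega)
    simp only [List.map_cons, List.countP_cons, List.flatMap_cons, labelsList_cons,
      List.count_append, e1, e2, e3, e]
    refine ⟨trivial, ?_, ?_⟩
    · rcases Nat.lt_or_ge (c.labels.count true) 1 with h | h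
      · have : c.labels.count true = 0 := by omega
        simp [this]
      · have : c.labels.count true = 1 := by omega
        simp [this, Nat.add_comm]
    · rcases Nat.lt_or_ge (c.labels.count true) 1 with h | h
      · have : c.labels.count true = 0 := by omega
        simp [this]
      · have : c.labels.count true = 1 := by omega
        have h' : (labelsList cs).count true = 0 := by omega
        simp [this, h']

/-- Let `c` be a small tree with at most one marked node, which is a leaf, and let a node that is
cut by the walk be grafted at this leaf. Then the walk does not cut any of the other nodes. -/
theorem walk_graft {K : ℕ} {kids : List MTree} {H : List DTree}
    (hk : walk K (node false kids) = ⟨true, node Mark.new [], H⟩) {c : MTree}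
    (hc : MarksAreLeaves c) (hcK : c.size < K) (h1 : c.labels.count true ≤ 1) :
    walk K (graft kids c) = ⟨decide (c.labels.count true = 1), c.map newMark,
      if c.labels.count true = 1 then H else []⟩ := by
  induction c using induct with
  | h a cs ih =>
    by_cases h0 : (node a cs).labels.count true = 0
    · rw [graft_eq_self kids h0, walk_light hcK, h0]
      simp only [zero_ne_one, decide_false, if_false, Branch.mk.injEq, true_and, and_true]
      refine map_congr fun b hb => ?_
      cases b with
      | false => rfl
      | true => exact absurd hb (List.count_eq_zero.1 h0)
    rw [marksAreLeaves_node] at hc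
    cases a with
    | true => rw [hc.1 rfl]; simpa [graft, newMark] using hk
    | false =>
      replace hc := hc.2
      have e0 : (node false cs).labels.count true = (labelsList cs).count true := by simp
      rw [e0] at h0 h1 ⊢
      rw [size_node] at hcK
      have hcK' : ∀ c ∈ cs, c.size < K := fun c h => by have := size_le_sum h; omega
      obtain ⟨e1, e2, e3⟩ := walk_graft_children ih hc hcK' h1
      have h1' : (labelsList cs).count true = 1 := by omega
      -- the tree is heavy because the child with the grafted node is
      have hK : K ≤ (node false (cs.map (graft kids))).size := by
        have hpos : 0 < ((cs.map (graft kids)).map (walk K)).countP (fun r => r.heavy) := by omega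
        obtain ⟨_, hr, hh⟩ := List.countP_pos_iff.1 hpos
        obtain ⟨d, hd, rfl⟩ := List.mem_map.1 hr
        have := size_le_sum hd
        rw [heavy_walk, decide_eq_true_eq] at hh
        rw [size_node]
        omega
      rw [graft, if_neg (by simp), graftList_eq, walk_heavy hK, if_neg (by omega), e1, e3, if_neg]
      · simp [h1', newMark]
      · simp only [List.map_map, Function.comp_def, size_map]
        change ¬ K ≤ 1 + (cs.map size).sum
        omega

/-! ### Forests of pieces with the same parameters -/

/-- The forest `D'` arises from the forest `D` of trees of a decomposition by exchanging every tree
for a member of the family with the same parameters. Equality after applying `f` to all the labels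
includes that the two forests have the same shape. -/
def Sim (T : OrdTree) (L : ℕ) (D' D : List DTree) : Prop :=
  D'.map (RTree.map (f T L)) = D.map (RTree.map (f T L)) ∧ ∀ o ∈ labelsList D', o ∈ family T L

variable {T : OrdTree} {L K : ℕ}

theorem Sim.eq_nil {D' : List DTree} (h : Sim T L D' []) : D' = [] := by
  simpa using h.1

theorem Sim.exists_cons {D' D H : List DTree} {o : Obj} (h : Sim T L D' (node o H :: D)) :
    ∃ o' H' D₁, D' = node o' H' :: D₁ ∧ f T L o' = f T L o ∧ o' ∈ family T L ∧
      Sim T L H' H ∧ Sim T L D₁ D := by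
  obtain ⟨h1, h2⟩ := h
  obtain ⟨⟨o', H'⟩, D₁, rfl, h3, h4⟩ := List.map_eq_cons_iff.1 h1
  simp only [map_node, node.injEq] at h3
  simp only [labelsList_cons, labels_node, List.mem_append, List.mem_cons] at h2
  exact ⟨o', H', D₁, rfl, h3.1, h2 _ (by simp), ⟨h3.2, fun o h => h2 o (by simp [h])⟩,
    ⟨h4, fun o h => h2 o (by simp [h])⟩⟩

theorem Sim.exists_append {D' D E : List DTree} (h : Sim T L D' (D ++ E)) :
    ∃ D₁ E₁, D' = D₁ ++ E₁ ∧ Sim T L D₁ D ∧ Sim T L E₁ E := by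
  obtain ⟨h1, h2⟩ := h
  rw [List.map_append] at h1
  obtain ⟨D₁, E₁, rfl, h3, h4⟩ := List.map_eq_append_iff.1 h1
  simp only [labelsList_append, List.mem_append] at h2
  exact ⟨D₁, E₁, rfl, ⟨h3, fun o h => h2 o (Or.inl h)⟩, ⟨h4, fun o h => h2 o (Or.inr h)⟩⟩

theorem Sim.eq_nil_iff {D' D : List DTree} (h : Sim T L D' D) : D' = [] ↔ D = [] := by
  have := congrArg List.length h.1
  simp only [List.length_map] at this
  rw [← List.length_eq_zero_iff, this, List.length_eq_zero_iff]

/-- The members of the family with the parameters of a non-empty tree are non-empty. -/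
theorem exists_of_f_eq {o : Obj} {p : MTree} (h : f T L o = f T L (some p)) :
    ∃ q, o = some q := by
  cases o with
  | some q => exact ⟨q, rfl⟩
  | none =>
    have := congrArg Params.size h
    have hp := size_pos p
    simp only [f] at this
    omega

/-- Statistics of a forest whose trees are to be the subtrees of the children of a root: the number
`n` of nodes, a bound `k` for the number of marks, the number `d` of trees; moreover all its nodes
are admissible as non-root nodes of a member of the family. -/
structure Counts (T : OrdTree) (ks : List MTree) (n k d : ℕ) : Prop where
  size : (ks.map RTree.size).sum = n
  marks : (labelsList ks).count true ≤ k
  length : ks.length = d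
  good : ∀ s ∈ subtreesList ks, (s.label = true → s.degree = 0) ∧ s.degree ∈ degSet T

theorem Counts.nil : Counts T [] 0 0 0 := ⟨rfl, by simp, rfl, by simp [subtreesList]⟩

theorem Counts.append {ks ks' : List MTree} {n n' k k' d d' : ℕ} (h : Counts T ks n k d)
    (h' : Counts T ks' n' k' d') : Counts T (ks ++ ks') (n + n') (k + k') (d + d') where
  size := by simp [h.size, h'.size]
  marks := by rw [labelsList_append, List.count_append]; exact Nat.add_le_add h.marks h'.marks
  length := by simp [h.length, h'.length]
  good s hs := by
    rw [subtreesList_append, List.mem_append] at hs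
    exact hs.elim (h.good s) (h'.good s)

theorem Counts.congr {ks : List MTree} {n n' k k' d d' : ℕ} (h : Counts T ks n k d)
    (hn : n = n') (hk : k ≤ k') (hd : d = d') : Counts T ks n' k' d' :=
  ⟨h.size.trans hn, h.marks.trans hk, h.length.trans hd, h.good⟩

/-- Whenever the trees in the forest `H` are exchanged for trees with the same parameters, the walk
in the joined tree cuts its root and finds the new forest. -/
def Cutable (T : OrdTree) (L K : ℕ) (H : List DTree) (n k d : ℕ) : Prop :=
  ∀ H', Sim T L H' H → walk K (node false (glueForest H')) = ⟨true, node Mark.new [], H'⟩ ∧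
    Counts T (glueForest H') n k d

/-- Whenever the trees in the forest `D` are exchanged for trees with the same parameters, the root
of the joined tree is heavy, and the new forest is the decomposition of the joined tree. -/
def Rebuilds (T : OrdTree) (L K : ℕ) (D : List DTree) (n k d : ℕ) : Prop :=
  ∀ D', Sim T L D' D → (walk K (node false (glueForest D'))).heavy = true ∧
    (walk K (node false (glueForest D'))).cut K = D' ∧ Counts T (glueForest D') n k d

theorem Cutable.rebuilds {H : List DTree} {n k d : ℕ} (h : Cutable T L K H n k d) :
    Rebuilds T L K H n k d := fun D' hD' => by
  obtain ⟨h1, h2⟩ := h D' hD'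
  rw [h1]
  exact ⟨rfl, by simp [Branch.cut, label], h2⟩

/-! ### A single piece -/

theorem hasNew_node_iff (g : List (RTree Mark)) :
    HasNew (node Mark.plain g) ↔ 0 < (labelsList g).count Mark.new := by
  simp [HasNew, List.count_pos_iff]

/-- The marking function that `finalize` applies. -/
def finalMark (n : Prop) [Decidable n] (m : Mark) : Bool :=
  if n then decide (m = Mark.new) else decide (m = Mark.old)

theorem finalize_node (g : List (RTree Mark)) :
    finalize (node Mark.plain g) =
      node false (g.map (RTree.map (finalMark (HasNew (node Mark.plain g))))) := by
  unfold finalize finalMark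
  split_ifs with h <;> simp

theorem finalize_newMark {q : MTree} (h0 : q.label = false) (h : HasMark q) :
    HasNew (node Mark.plain (q.children.map (RTree.map newMark))) ∧
    finalize (node Mark.plain (q.children.map (RTree.map newMark))) = q := by
  obtain ⟨a, cs⟩ := q
  cases h0
  have h' : HasNew (node Mark.plain (cs.map (RTree.map newMark))) := by
    simp only [HasMark, labels_node, List.mem_cons, Bool.true_eq_false, false_or] at h
    simp only [HasNew, labels_node, labelsList_map, List.mem_cons, reduceCtorEq, List.mem_map,
      false_or]
    exact ⟨true, h, rfl⟩
  refine ⟨h', ?_⟩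
  simp only [children]
  rw [finalize_node, node.injEq]
  refine ⟨rfl, ?_⟩
  rw [List.map_map]
  conv_rhs => rw [← List.map_id cs]
  rw [List.map_inj_left]
  intro c _
  simp only [Function.comp, RTree.map_map, id]
  refine map_id_of fun b _ => ?_
  cases b <;> simp [finalMark, h', newMark]

theorem finalize_oldMark {q : MTree} (h0 : q.label = false) :
    ¬ HasNew (node Mark.plain (q.children.map (RTree.map oldMark))) ∧
    finalize (node Mark.plain (q.children.map (RTree.map oldMark))) = q := by
  obtain ⟨a, cs⟩ := q
  cases h0
  have h' : ¬ HasNew (node Mark.plain (cs.map (RTree.map oldMark))) := by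
    simp only [HasNew, labels_node, labelsList_map, List.mem_cons, reduceCtorEq, List.mem_map,
      false_or]
    rintro ⟨b, -, hb⟩
    cases b <;> simp [oldMark] at hb
  refine ⟨h', ?_⟩
  simp only [children]
  rw [finalize_node, node.injEq]
  refine ⟨rfl, ?_⟩
  rw [List.map_map]
  conv_rhs => rw [← List.map_id cs]
  rw [List.map_inj_left]
  intro c _
  simp only [Function.comp, RTree.map_map, id]
  refine map_id_of fun b _ => ?_
  cases b <;> simp [finalMark, h', oldMark]

theorem sum_dropLast_add_sizeRight (cs : List MTree) :
    (cs.dropLast.map size).sum + ((cs.getLast?.map size).getD 0) = (cs.map size).sum := by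
  by_cases h : cs = []
  · simp [h]
  · conv_rhs => rw [← List.dropLast_append_getLast h]
    simp [List.getLast?_eq_some_getLast h]

/-- What the parameters of a piece tell about a tree `q` of the family with the same parameters.
Here `g` is the group of trees below the root of the piece. -/
theorem params_of_f_eq {g : List (RTree Mark)} {q : MTree} (hK : 0 < K)
    (hg : ∀ x ∈ g, x.size < K) (hq : some q ∈ family T L)
    (hf : f T L (some q) = f T L (some (finalize (node Mark.plain g)))) :
    (q.children.map size).sum = (g.map size).sum ∧
    (q.children.dropLast.map size).sum = (g.dropLast.map size).sum ∧
    q.children.length = g.length ∧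
    (∀ c ∈ q.children, c.size < K) ∧
    (HasMark q ↔ HasMark (finalize (node Mark.plain g))) := by
  obtain ⟨h, hp⟩ : ∃ h, finalize (node Mark.plain g) = node false (g.map (RTree.map h)) :=
    ⟨_, finalize_node g⟩
  obtain ⟨-, -, h3, h4, -⟩ := hq q rfl
  have e := Params.ext_iff.1 hf
  generalize finalize (node Mark.plain g) = p at *
  obtain ⟨-, e1, e2, e3, e4, e5, -, e7⟩ := e
  simp only [f] at e1 e2 e3 e4 e5 e7
  have hpK : ∀ c ∈ p.children, c.size < K := by
    rw [hp]
    simp only [children, List.mem_map]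
    rintro _ ⟨x, hx, rfl⟩
    rw [size_map]
    exact hg x hx
  have s1 : (q.children.map size).sum = (g.map size).sum := by
    obtain ⟨a, cs⟩ := q
    rw [hp] at e1
    simp only [size_node, List.map_map, Function.comp_def, size_map] at e1
    change 1 + (cs.map size).sum = 1 + (g.map size).sum at e1
    simp only [children]
    omega
  refine ⟨s1, ?_, ?_, ?_, ?_⟩
  · have r1 := sum_dropLast_add_sizeRight q.children
    have r2 := sum_dropLast_add_sizeRight p.children
    simp only [sizeRight] at e2
    have r3 : (p.children.map size).sum = (g.map size).sum := by
      rw [hp]; simp [children, List.map_map, Function.comp_def]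
    have r4 : (p.children.dropLast.map size).sum = (g.dropLast.map size).sum := by
      rw [hp]; simp [children, List.map_dropLast, List.map_map, Function.comp_def]
    omega
  · rw [hp] at e5
    simpa [RTree.degree, children] using e5
  · refine children_size_lt hK h3 ?_ ?_
    · rw [e4]; exact sizeMax_lt hK hpK
    · rw [e3]; exact sizeBoundary_lt hK hpK
  · rw [hasMark_iff_preorder h4, hasMark_iff_preorder (by rw [hp]; rfl), e7]

theorem hasMark_finalize_of_hasNew {g : List (RTree Mark)} (h : HasNew (node Mark.plain g)) :
    HasMark (finalize (node Mark.plain g)) := by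
  rw [finalize_node]
  simp only [HasNew, labels_node, List.mem_cons, reduceCtorEq, false_or] at h
  simp only [HasMark, labels_node, List.mem_cons, labelsList_map, List.mem_map]
  exact Or.inr ⟨_, h, by simp [finalMark, HasNew, h]⟩

theorem hasMark_finalize_of_not_hasNew {g : List (RTree Mark)}
    (h : ¬ HasNew (node Mark.plain g)) (hm : HasMark (finalize (node Mark.plain g))) :
    0 < (labelsList g).count Mark.old := by
  rw [finalize_node] at hm
  simp only [HasMark, labels_node, List.mem_cons, labelsList_map, List.mem_map,
    Bool.true_eq_false, false_or, finalMark, if_neg h, decide_eq_true_eq] at hm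
  obtain ⟨_, ha, rfl⟩ := hm
  exact List.count_pos_iff.2 ha

/-- The results of the walk for the trees of a forest: the list of the cut off trees, the number of
heavy trees, and everything that hangs from the cut off trees. -/
structure Reads (K : ℕ) (ks : List MTree) (ts : List (RTree Mark)) (c : ℕ) (X : List DTree) :
    Prop where
  trees : (ks.map (walk K)).map Branch.tree = ts
  heavy : (ks.map (walk K)).countP (fun r => r.heavy) = c
  hang : (ks.map (walk K)).flatMap Branch.hang = X

theorem Reads.append {ks ks' : List MTree} {ts ts' : List (RTree Mark)} {c c' : ℕ}
    {X X' : List DTree} (h : Reads K ks ts c X) (h' : Reads K ks' ts' c' X') :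
    Reads K (ks ++ ks') (ts ++ ts') (c + c') (X ++ X') where
  trees := by simp only [List.map_append, h.trees, h'.trees]
  heavy := by simp only [List.map_append, List.countP_append, h.heavy, h'.heavy]
  hang := by simp only [List.map_append, List.flatMap_append, h.hang, h'.hang]

theorem Reads.of_light {ks : List MTree} (h : ∀ c ∈ ks, c.size < K) :
    Reads K ks (ks.map (RTree.map oldMark)) 0 [] := by
  induction ks with
  | nil => exact ⟨rfl, rfl, rfl⟩
  | cons c ks ih =>
    obtain ⟨h1, h2, h3⟩ := ih fun c hc => h c (by simp [hc])
    have e := walk_light (h c (by simp))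
    exact ⟨by simp only [List.map_cons, e, h1],
      by simp only [List.map_cons, List.countP_cons, e, h2]; rfl,
      by simp only [List.map_cons, List.flatMap_cons, e, h3]; rfl⟩

/-- The group `g'` is non-empty and cannot be told from `g` by packing, and it contains a new
boundary leaf if and only if `g` does. -/
def SameShape (g g' : List (RTree Mark)) : Prop :=
  (g' ≠ [] ∧ (g'.map size).sum = (g.map size).sum ∧
    (g'.dropLast.map size).sum = (g.dropLast.map size).sum) ∧
  (HasNew (node Mark.plain g') ↔ HasNew (node Mark.plain g))

/-- There is at most one new boundary leaf in the trees `ts`. If there is one, `H` can hang from it: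
the walk recovers `H` and cuts the root of its join. -/
def HangsWell (T : OrdTree) (L K : ℕ) (ts : List (RTree Mark)) (H : List DTree) (n k d : ℕ) :
    Prop :=
  (labelsList ts).count Mark.new ≤ 1 ∧
    (0 < (labelsList ts).count Mark.new → H ≠ [] ∧ d ∈ degSet T ∧ Cutable T L K H n k d)

/-- A piece below which the forest `H` may hang is exchanged for a tree `o` with the same
parameters, and `H` for `H'`: below the root, the walk finds the new piece and `H'` again. -/
theorem piece_spec (hK : 0 < K) {g : List (RTree Mark)} (hg0 : g ≠ [])
    (hg : ∀ x ∈ g, x.size < K) {H : List DTree} {n k d : ℕ} (hH : HangsWell T L K g H n k d)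
    {o : Obj} {H' : List DTree} (ho : o ∈ family T L)
    (hf : f T L o = f T L (some (finalize (node Mark.plain g))))
    (hs : Sim T L H' (if HasNew (node Mark.plain g) then H else [])) :
    ∃ g', o = some (finalize (node Mark.plain g')) ∧ SameShape g g' ∧
      Reads K (glueTree (node o H')) g' ((labelsList g).count Mark.new) H' ∧
      (¬ HasNew (node Mark.plain g) → H' = []) ∧
      Counts T (glueTree (node o H')) ((g.map size).sum + (labelsList g).count Mark.new * n)
        ((labelsList g).count Mark.old + (labelsList g).count Mark.new * k) g.length := by
  obtain ⟨q, rfl⟩ := exists_of_f_eq hf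
  obtain ⟨p1, p2, p3, p4, p5⟩ := params_of_f_eq hK hg ho hf
  obtain ⟨-, f2, f3, f4, f5⟩ := ho q rfl
  have hne : q.children ≠ [] := by
    rw [← List.length_pos_iff, p3]
    exact List.length_pos_iff.2 hg0
  have hcnt : q.labels.count true = (labelsList q.children).count true := by
    obtain ⟨a, cs⟩ := q
    cases f4
    simp [children]
  have hleaf : ∀ c ∈ q.children, MarksAreLeaves c := by
    have : MarksAreLeaves q := f5
    obtain ⟨a, cs⟩ := q
    exact (marksAreLeaves_node.1 this).2
  have hgood : ∀ s ∈ subtreesList q.children,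
      (s.label = true → s.degree = 0) ∧ s.degree ∈ degSet T := by
    refine fun s hs => ⟨fun hl => ?_, f2 s hs⟩
    have : s ∈ q.subtrees := by
      obtain ⟨a, cs⟩ := q
      rw [subtrees]
      exact List.mem_cons_of_mem _ hs
    simp [RTree.degree, f5 s this hl]
  have hsum (m : Bool → Mark) :
      ((q.children.map (RTree.map m)).map size).sum = (g.map size).sum := by
    rw [← p1]
    simp [List.map_map, Function.comp_def]
  have hsum' (m : Bool → Mark) :
      ((q.children.map (RTree.map m)).dropLast.map size).sum = (g.dropLast.map size).sum := by
    rw [← p2]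
    simp [List.map_map, Function.comp_def, List.map_dropLast]
  rw [hcnt] at f3
  by_cases hN : HasNew (node Mark.plain g)
  · have hpos := (hasNew_node_iff g).1 hN
    have h1 : (labelsList g).count Mark.new = 1 := by have := hH.1; omega
    obtain ⟨hH1, hH2, hH3⟩ := hH.2 hpos
    rw [if_pos hN] at hs
    obtain ⟨w, wc⟩ := hH3 H' hs
    have hH' : H' ≠ [] := fun h => hH1 (hs.eq_nil_iff.1 h)
    have hm : HasMark q := p5.2 (hasMark_finalize_of_hasNew hN)
    have hm1 : (labelsList q.children).count true = 1 := by
      rw [hasMark_iff_count, hcnt] at hm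
      omega
    obtain ⟨e1, e2⟩ := finalize_newMark f4 hm
    have eg : glueTree (node (some q) H') = q.children.map (graft (glueForest H')) := by
      simp only [glueTree, if_neg hH', graftList_eq]
    obtain ⟨r1, r2, r3⟩ := walk_graft_children
      (fun c _ h1 h2 h3 => walk_graft w h1 h2 h3) hleaf p4 f3
    rw [eg, h1]
    refine ⟨q.children.map (RTree.map newMark), by rw [e2], ⟨⟨by simpa using hne, hsum _, hsum' _⟩,
      iff_of_true e1 hN⟩, ⟨r1, by rw [r2, hm1], by rw [r3, if_pos hm1]⟩, absurd hN, ?_, ?_, ?_, ?_⟩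
    · rw [sum_size_graft fun c hc => size_graft _ (hleaf c hc), hm1, wc.size, p1]
    · rw [count_labelsList_graft fun c hc => count_graft _ (hleaf c hc), hm1]
      have := wc.marks
      omega
    · rw [List.length_map, p3]
    · intro s hs
      obtain ⟨_, hx, hs⟩ := mem_subtreesList.1 hs
      obtain ⟨c, hc, rfl⟩ := List.mem_map.1 hx
      refine forall_subtrees_graft (P := fun b i => (b = true → i = 0) ∧ i ∈ degSet T)
        (fun s hs => hgood s (mem_subtreesList.2 ⟨c, hc, hs⟩)) ?_ wc.good s hs
      exact ⟨by simp, by rw [wc.length]; exact hH2⟩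
  · have h0 : (labelsList g).count Mark.new = 0 := by rw [hasNew_node_iff] at hN; omega
    rw [if_neg hN] at hs
    cases hs.eq_nil
    obtain ⟨e1, e2⟩ := finalize_oldMark f4
    have eg : glueTree (node (some q) []) = q.children := by simp [glueTree]
    rw [eg, h0]
    refine ⟨q.children.map (RTree.map oldMark), by rw [e2], ⟨⟨by simpa using hne, hsum _, hsum' _⟩,
      iff_of_false e1 hN⟩, Reads.of_light p4, fun _ => rfl, by simpa using p1, ?_, p3, hgood⟩
    rcases Nat.eq_zero_or_pos ((labelsList q.children).count true) with h | h
    · omega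
    · have hm : HasMark q := by rwa [hasMark_iff_count, hcnt]
      have := hasMark_finalize_of_not_hasNew hN (p5.1 hm)
      omega

/-- The trees that `packed` makes of the groups `gs`; `H` hangs from the group with the new
boundary leaf. -/
def hangGroups (gs : List (List (RTree Mark))) (H : List DTree) : List DTree :=
  gs.map fun g => node (some (finalize (node Mark.plain g)))
    (if HasNew (node Mark.plain g) then H else [])

theorem hangGroups_congr {gs : List (List (RTree Mark))}
    (h : ∀ g ∈ gs, ¬ HasNew (node Mark.plain g)) (H H' : List DTree) :
    hangGroups gs H = hangGroups gs H' := by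
  unfold hangGroups
  rw [List.map_inj_left]
  intro g hg
  rw [if_neg (h g hg), if_neg (h g hg)]

theorem not_hasNew_of_forall₂ {gs gs' : List (List (RTree Mark))}
    (h : List.Forall₂ SameShape gs gs') (h0 : (labelsList gs.flatten).count Mark.new = 0) :
    ∀ g ∈ gs', ¬ HasNew (node Mark.plain g) := by
  induction h with
  | nil => simp
  | cons a b ih =>
    simp only [List.flatten_cons, labelsList_append, List.count_append] at h0
    simp only [List.mem_cons, forall_eq_or_imp]
    refine ⟨?_, ih (by omega)⟩
    rw [a.2, hasNew_node_iff]
    omega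

/-- The version of `piece_spec` for all the groups of a packed list. -/
theorem hangGroups_spec (hK : 0 < K) {gs : List (List (RTree Mark))}
    (hg0 : ∀ g ∈ gs, g ≠ []) (hg : ∀ x ∈ gs.flatten, x.size < K) {H : List DTree} {n k d : ℕ}
    (hH : HangsWell T L K gs.flatten H n k d) {D' : List DTree}
    (hs : Sim T L D' (hangGroups gs H)) :
    ∃ gs' X, D' = hangGroups gs' X ∧ List.Forall₂ SameShape gs gs' ∧
      Reads K (glueForest D') gs'.flatten ((labelsList gs.flatten).count Mark.new) X ∧
      ((labelsList gs.flatten).count Mark.new = 0 → X = []) ∧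
      Counts T (glueForest D')
        ((gs.flatten.map size).sum + (labelsList gs.flatten).count Mark.new * n)
        ((labelsList gs.flatten).count Mark.old + (labelsList gs.flatten).count Mark.new * k)
        gs.flatten.length := by
  induction gs generalizing D' with
  | nil =>
    cases hs.eq_nil
    exact ⟨[], [], rfl, .nil, ⟨rfl, rfl, rfl⟩, fun _ => rfl, by simpa [glueForest] using Counts.nil⟩
  | cons g gs ih =>
    obtain ⟨o, H', D₁, rfl, hf, ho, hs1, hs2⟩ := hs.exists_cons
    simp only [HangsWell, List.flatten_cons, labelsList_append, List.count_append] at hH ⊢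
    simp only [List.flatten_cons, List.mem_append] at hg
    obtain ⟨g', rfl, s1, r1, x1, c1⟩ := piece_spec hK (hg0 g (by simp))
      (fun x hx => hg x (Or.inl hx)) (n := n) (k := k) (d := d)
      ⟨by omega, fun h => hH.2 (by omega)⟩ ho hf hs1
    obtain ⟨gs', X, rfl, s2, r2, x2, c2⟩ := ih (fun g hg => hg0 g (by simp [hg]))
      (fun x hx => hg x (Or.inr hx)) ⟨by omega, fun h => hH.2 (by omega)⟩ hs2
    refine ⟨g' :: gs', H' ++ X, ?_, .cons s1 s2, ?_, ?_, ?_⟩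
    · by_cases hN : HasNew (node Mark.plain g)
      · -- only one of the groups contains the new boundary leaf
        have hpos := (hasNew_node_iff g).1 hN
        have h0 : (labelsList gs.flatten).count Mark.new = 0 := by omega
        rw [x2 h0, List.append_nil]
        have hno := not_hasNew_of_forall₂ s2 h0
        rw [hangGroups_congr hno [] H']
        simp only [hangGroups, List.map_cons, if_pos (s1.2.2 hN)]
      · rw [x1 hN, List.nil_append]
        simp only [hangGroups, List.map_cons, if_neg (fun h => hN (s1.2.1 h))]
    · exact r1.append r2
    · intro h0
      rw [x1 (by rw [hasNew_node_iff]; omega), x2 (by omega)]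
      rfl
    · refine (c1.append c2).congr ?_ ?_ (by simp)
      · simp only [List.map_append, List.sum_append]; ring
      · exact le_of_eq (by ring)

/-! ### Packed forests -/

theorem packed_eq (K : ℕ) (ys : List (RTree Mark)) (H : List DTree) :
    packed K ys H = hangGroups (pack K [] ys) H := rfl

theorem packed_ne_nil {ys : List (RTree Mark)} (hK : 2 ≤ K) (h : ys ≠ []) (H : List DTree) :
    packed K ys H ≠ [] := by
  intro h0
  rw [packed_eq, hangGroups, List.map_eq_nil_iff] at h0
  have := (pack_spec hK ys [] (by simp; omega)).1
  rw [h0] at this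
  exact h (by simpa using this.symm)

/-- The forest packed from trees of less than `K` nodes is recovered from the join of any trees
with the same parameters. -/
theorem packed_spec (hK : 2 ≤ K) {ts : List (RTree Mark)} (hts : ∀ x ∈ ts, x.size < K)
    {H : List DTree} {n k d : ℕ} (hH : HangsWell T L K ts H n k d) {D' : List DTree}
    (hs : Sim T L D' (packed K ts H)) :
    ∃ ts' X, D' = packed K ts' X ∧ (ts'.map size).sum = (ts.map size).sum ∧
      Reads K (glueForest D') ts' ((labelsList ts).count Mark.new) X ∧
      ((labelsList ts).count Mark.new = 0 → X = []) ∧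
      Counts T (glueForest D')
        ((ts.map size).sum + (labelsList ts).count Mark.new * n)
        ((labelsList ts).count Mark.old + (labelsList ts).count Mark.new * k) ts.length := by
  obtain ⟨h1, h2⟩ := pack_spec hK ts [] (by simp; omega)
  rw [List.nil_append] at h1
  rw [packed_eq] at hs
  generalize pack K [] ts = gs at h1 h2 hs
  subst h1
  have hne : ∀ g ∈ gs, g ≠ [] := by
    clear hts hH hs
    induction gs with
    | nil => simp
    | cons g gs ih => simpa using ⟨h2.1, ih h2.2.2.2⟩
  obtain ⟨gs', X, e, s, r, x, c⟩ := hangGroups_spec (by omega) hne hts hH hs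
  refine ⟨gs'.flatten, X, ?_, ?_, r, x, c⟩
  · rw [packed_eq, IsPacking.pack_flatten (h2.of_forall₂ (s.imp fun _ _ h => h.1)), e]
  · clear hts hH hs h2 hne e r x c
    induction s with
    | nil => rfl
    | cons a _ ih => simp only [List.flatten_cons, List.map_append, List.sum_append, ih, a.1.2.1]

/-! ### Nodes with at least two heavy children -/

theorem typeTwo_light (rs rs' : List Branch) (h : ∀ r ∈ rs, r.heavy = false)
    (run : List (RTree Mark)) :
    typeTwo K run (rs ++ rs') = typeTwo K (run ++ rs.map Branch.tree) rs' := by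
  induction rs generalizing run with
  | nil => simp
  | cons r rs ih =>
    rw [List.cons_append, typeTwo, if_neg (by simp [h r (by simp)]),
      ih fun r hr => h r (by simp [hr])]
    simp

/-- The induction hypothesis for a subtree `t`, if it is heavy: the forest of the pieces rooted at
the root of `t` or below is recovered, and so is the forest that hangs from the new boundary leaf of
the upper part of `t` that the walk leaves to the parent. -/
structure ChildSpec (T : OrdTree) (L K : ℕ) (t : MTree) : Prop where
  rebuilds : K ≤ t.size → (walk K t).cut K ≠ [] ∧
    Rebuilds T L K ((walk K t).cut K) (t.children.map size).sum
      ((labelsList t.children).count true) t.degree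
  hangs : K ≤ t.size → (walk K t).hang ≠ [] ∧ (walk K t).tree.size < K ∧
    (walk K t).tree.labels.count Mark.new = 1 ∧
    ∃ n k d, d ∈ degSet T ∧ Cutable T L K (walk K t).hang n k d ∧
      t.size = (walk K t).tree.size + n ∧
      (walk K t).tree.labels.count Mark.old + k ≤ t.labels.count true

/-- The tree with two nodes and a boundary leaf is the only one with its parameters. -/
theorem eq_edge {o : Obj} (ho : o ∈ family T L)
    (h : f T L o = f T L (some (node false [node true []]))) :
    o = some (node false [node true []]) := by
  obtain ⟨q, rfl⟩ := exists_of_f_eq h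
  obtain ⟨-, -, -, h4, -⟩ := ho q rfl
  have e1 := congrArg Params.size h
  have e2 := congrArg Params.degree h
  have e3 := congrArg Params.preorder h
  simp only [f] at e1 e2 e3
  obtain ⟨a, cs⟩ := q
  cases h4
  obtain ⟨⟨b, ds⟩, rfl⟩ : ∃ c, cs = [c] := by
    rw [← List.length_eq_one_iff]
    simpa [RTree.degree, children] using e2
  have hds : ds = [] := by
    cases ds with
    | nil => rfl
    | cons d ds =>
      have := size_pos d
      simp at e1
      omega
  subst hds
  cases b with
  | true => rfl
  | false =>
    have hm := (hasMark_iff_preorder (t := node false [node true []]) rfl).1 (by simp [HasMark])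
    rw [← e3] at hm
    have := (hasMark_iff_preorder (t := node false [node false []]) rfl).2 hm
    simp [HasMark] at this

theorem count_old_map_oldMark (t : MTree) :
    (t.map oldMark).labels.count Mark.old = t.labels.count true := by
  rw [labels_map]
  generalize t.labels = l
  induction l with
  | nil => rfl
  | cons b l ih => cases b <;> simp [oldMark, ih]

theorem new_not_mem_map_oldMark (t : MTree) : Mark.new ∉ (t.map oldMark).labels := by
  rw [labels_map, List.mem_map]
  rintro ⟨b, -, hb⟩
  cases b <;> simp [oldMark] at hb

/-- A run of light children is recovered from the join of any trees with the same parameters as the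
pieces packed from it. -/
theorem packed_light_spec (hK : 2 ≤ K) {run : List (RTree Mark)} (hrun : ∀ x ∈ run, x.size < K)
    (hnew : Mark.new ∉ labelsList run) {D' : List DTree} (hs : Sim T L D' (packed K run [])) :
    (∀ r ∈ (glueForest D').map (walk K), r.heavy = false) ∧
      packed K (((glueForest D').map (walk K)).map Branch.tree) [] = D' ∧
      Counts T (glueForest D') (run.map size).sum ((labelsList run).count Mark.old)
        run.length := by
  have h0 := List.count_eq_zero.2 hnew
  have hw : HangsWell T L K run [] 0 0 0 := by
    rw [HangsWell, h0]; simp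
  obtain ⟨ts', X, e, -, r, x, c⟩ := packed_spec hK hrun hw hs
  rw [h0] at r x c
  rw [x rfl] at e
  refine ⟨fun b hb => ?_, by rw [r.trees, e], by simpa using c⟩
  simpa using List.countP_eq_zero.1 r.heavy b hb

theorem typeTwo_ne_nil {rs : List Branch} (h : 0 < rs.countP (fun r => r.heavy))
    (run : List (RTree Mark)) : typeTwo K run rs ≠ [] := by
  induction rs generalizing run with
  | nil => simp at h
  | cons r rs ih =>
    rw [typeTwo]
    split_ifs with hr
    · simp
    · refine ih ?_ _
      rwa [List.countP_cons, if_neg hr] at h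

/-- The forest of the trees at a node with several heavy children is recovered from the join of any
trees with the same parameters. The light trees in `run` have been collected already. -/
theorem typeTwo_spec (hK : 2 ≤ K) {cs : List MTree} (hcs : ∀ c ∈ cs, ChildSpec T L K c)
    (hd : ∀ c ∈ cs, c.degree ∈ degSet T)
    {run : List (RTree Mark)} (hrun : ∀ x ∈ run, x.size < K) (hnew : Mark.new ∉ labelsList run)
    {D' : List DTree} (hs : Sim T L D' (typeTwo K run (cs.map (walk K)))) :
    typeTwo K [] ((glueForest D').map (walk K)) = D' ∧
      ((glueForest D').map (walk K)).countP (fun r => r.heavy)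
        = (cs.map (walk K)).countP (fun r => r.heavy) ∧
      Counts T (glueForest D') ((run.map size).sum + (cs.map size).sum)
        ((labelsList run).count Mark.old + (labelsList cs).count true)
        (run.length + cs.length) := by
  induction cs generalizing run D' with
  | nil =>
    obtain ⟨r, e, c⟩ := packed_light_spec hK hrun hnew hs
    refine ⟨?_, ?_, by simpa using c⟩
    · have := typeTwo_light (K := K) _ [] r []
      rw [List.append_nil] at this
      rw [this, List.nil_append, typeTwo, e]
    · exact List.countP_eq_zero.2 fun b hb => by simp [r b hb]
  | cons c cs ih =>
    rw [List.map_cons, typeTwo] at hs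
    split_ifs at hs with hc
    · rw [heavy_walk, decide_eq_true_eq] at hc
      obtain ⟨D₁, D₂, rfl, hs1, hs2⟩ := hs.exists_append
      obtain ⟨o, H', D₃, rfl, hf, ho, hs3, hs4⟩ := hs2.exists_cons
      cases eq_edge ho hf
      obtain ⟨r1, e1, c1⟩ := packed_light_spec hK hrun hnew hs1
      obtain ⟨e2, e3, c2⟩ := ih (fun c h => hcs c (by simp [h])) (fun c h => hd c (by simp [h]))
        (run := []) (by simp) (by simp) hs4
      obtain ⟨hne, hr⟩ := (hcs c (by simp)).rebuilds hc
      obtain ⟨w1, w2, w3⟩ := hr H' hs3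
      have eg : glueTree (node (some (node false [node true []])) H')
          = [node false (glueForest H')] := by
        have : H' ≠ [] := fun h => hne (hs3.eq_nil_iff.1 h)
        simp [glueTree, this, graftList, graft, children]
      have hlt := hd c (by simp)
      have c3 : Counts T [node false (glueForest H')] c.size (c.labels.count true) 1 := by
        obtain ⟨a, ds⟩ := c
        refine ⟨by simp [w3.size, children], ?_, rfl, ?_⟩
        · have := w3.marks
          simp only [children] at this
          simp only [labelsList_cons, labels_node, labelsList_nil, List.append_nil,
            List.count_cons]
          simp
          omega
        · simp only [subtreesList, subtrees, List.append_nil, List.mem_cons, forall_eq_or_imp]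
          refine ⟨⟨by simp [label], ?_⟩, w3.good⟩
          rw [← w3.length] at hlt
          exact hlt
      rw [glueForest_append, glueForest, eg]
      simp only [List.map_append, List.map_cons, List.map_nil]
      refine ⟨?_, ?_, ?_⟩
      · rw [typeTwo_light _ _ r1, List.nil_append, List.singleton_append, typeTwo, if_pos w1, w2,
          e2, e1]
      · have r0 : ((glueForest D₁).map (walk K)).countP (fun r => r.heavy) = 0 :=
          List.countP_eq_zero.2 fun b hb => by simp [r1 b hb]
        rw [List.countP_append, r0, List.countP_append, e3, List.countP_cons,
          List.countP_cons, if_pos w1, if_pos (by rw [heavy_walk]; simpa using hc)]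
        simp only [List.countP_nil]
        omega
      · refine (c1.append (c3.append c2)).congr (by simp) (by simp) ?_
        simp
        omega
    · have hlt : c.size < K := by
        rw [heavy_walk, decide_eq_true_eq] at hc; omega
      rw [walk_light hlt] at hs
      have h1 : (labelsList [c.map oldMark]).count Mark.old = c.labels.count true := by
        simp [count_old_map_oldMark]
      have hnew' : Mark.new ∉ labelsList (run ++ [c.map oldMark]) := by
        simp [hnew, new_not_mem_map_oldMark]
      obtain ⟨e2, e3, c2⟩ := ih (fun c h => hcs c (by simp [h])) (fun c h => hd c (by simp [h]))
        (run := run ++ [c.map oldMark])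
        (by simp only [List.mem_append, List.mem_singleton]
            rintro x (h | rfl)
            · exact hrun x h
            · simpa using hlt)
        hnew' hs
      refine ⟨e2, ?_, c2.congr ?_ ?_ ?_⟩
      · rw [e3, List.map_cons, List.countP_cons, if_neg hc]
        rfl
      · simp; omega
      · rw [labelsList_append, List.count_append, h1, labelsList_cons, List.count_append]; omega
      · simp; omega

/-! ### The decomposition of a whole tree -/

/-- If at most one child is heavy, there is at most one new boundary leaf in the trees that the walk
returns for the children, and these are all small. -/
theorem children_spec {cs : List MTree} (hcs : ∀ c ∈ cs, ChildSpec T L K c)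
    (h1 : (cs.map (walk K)).countP (fun r => r.heavy) ≤ 1) :
    let ts := (cs.map (walk K)).map Branch.tree
    let H := (cs.map (walk K)).flatMap Branch.hang
    let c := (labelsList ts).count Mark.new
    ∃ n k d, HangsWell T L K ts H n k d ∧ (∀ x ∈ ts, x.size < K) ∧
      c = (cs.map (walk K)).countP (fun r => r.heavy) ∧ (c = 0 → H = []) ∧
      (cs.map size).sum = (ts.map size).sum + c * n ∧
      (labelsList ts).count Mark.old + c * k ≤ (labelsList cs).count true := by
  induction cs with
  | nil => exact ⟨0, 0, 0, by simp [HangsWell]⟩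
  | cons c cs ih =>
    rw [List.map_cons, List.countP_cons] at h1
    obtain ⟨n, k, d, ⟨hw1, hw2⟩, hsz, hc, h0, hn, hk⟩ := ih (fun c h => hcs c (by simp [h]))
      (by omega)
    simp only [List.map_cons, labelsList_cons, List.count_append, List.flatMap_cons,
      List.mem_cons, forall_eq_or_imp, List.countP_cons, List.sum_cons, HangsWell]
    by_cases hh : K ≤ c.size
    · obtain ⟨a1, a2, a3, n', k', d', a4, a5, a6, a7⟩ := (hcs c (by simp)).hangs hh
      have hv : (walk K c).heavy = true := by rw [heavy_walk]; simpa using hh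
      rw [hv, if_pos rfl] at h1
      have z : (labelsList ((cs.map (walk K)).map Branch.tree)).count Mark.new = 0 := by omega
      rw [z] at hc hn hk
      simp only [a3, z, h0 z, hv, if_pos, List.append_nil]
      exact ⟨n', k', d', ⟨le_rfl, fun _ => ⟨a1, a4, a5⟩⟩, ⟨a2, hsz⟩, by omega, by simp, by omega,
        by omega⟩
    · have hlt : c.size < K := by omega
      have hv : (walk K c).heavy = false := by rw [heavy_walk]; simpa using hlt
      have z := List.count_eq_zero.2 (new_not_mem_map_oldMark c)
      have e := walk_light hlt
      have hold := count_old_map_oldMark c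
      simp only [e, z, size_map, hold, List.nil_append, Nat.zero_add]
      exact ⟨n, k, d, ⟨hw1, hw2⟩, ⟨hlt, hsz⟩, by simpa using hc, h0, by omega, by omega⟩

/-- The decomposition below a heavy node is recovered from the join of any trees with the same
parameters as its pieces. -/
theorem node_spec (hK : 2 ≤ K) {m : Bool} {cs : List MTree} (hcs : ∀ c ∈ cs, ChildSpec T L K c)
    (hd : ∀ c ∈ cs, c.degree ∈ degSet T) (h : K ≤ (node m cs).size) :
    let r := walk K (node m cs)
    (r.cut K ≠ [] ∧ Rebuilds T L K (r.cut K) (cs.map size).sum ((labelsList cs).count true)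
      cs.length) ∧
    (cs.length ∈ degSet T → ChildSpec T L K (node m cs)) := by
  suffices hsuff : let r := walk K (node m cs)
      (r.cut K ≠ [] ∧ Rebuilds T L K (r.cut K) (cs.map size).sum ((labelsList cs).count true)
        cs.length) ∧
      (cs.length ∈ degSet T → r.hang ≠ [] ∧ r.tree.size < K ∧
        r.tree.labels.count Mark.new = 1 ∧
        ∃ n k d, d ∈ degSet T ∧ Cutable T L K r.hang n k d ∧
          (node m cs).size = r.tree.size + n ∧
          r.tree.labels.count Mark.old + k ≤ (node m cs).labels.count true) from
    ⟨hsuff.1, fun hdeg => ⟨fun _ => hsuff.1, fun _ => hsuff.2 hdeg⟩⟩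
  -- a node that is cut by the walk
  have cutCase : ∀ H, walk K (node m cs) = ⟨true, node Mark.new [], H⟩ → H ≠ [] →
      Cutable T L K H (cs.map size).sum ((labelsList cs).count true) cs.length →
      let r := walk K (node m cs)
      (r.cut K ≠ [] ∧ Rebuilds T L K (r.cut K) (cs.map size).sum ((labelsList cs).count true)
        cs.length) ∧
      (cs.length ∈ degSet T → r.hang ≠ [] ∧ r.tree.size < K ∧
        r.tree.labels.count Mark.new = 1 ∧
        ∃ n k d, d ∈ degSet T ∧ Cutable T L K r.hang n k d ∧
          (node m cs).size = r.tree.size + n ∧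
          r.tree.labels.count Mark.old + k ≤ (node m cs).labels.count true) := by
    intro H e hne hcut
    have ec : (walk K (node m cs)).cut K = H := by rw [e]; simp [Branch.cut, label]
    simp only [ec]
    rw [e]
    refine ⟨⟨hne, hcut.rebuilds⟩, fun hdeg => ⟨hne, by simp; omega, by simp, _, _, _, hdeg, hcut,
      by simp, ?_⟩⟩
    simp [List.count_cons]
  have hw := walk_heavy h
  by_cases h2 : 2 ≤ (cs.map (walk K)).countP (fun r => r.heavy)
  · rw [if_pos h2] at hw
    refine cutCase _ hw (typeTwo_ne_nil (by omega) []) fun D' hs => ?_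
    obtain ⟨e1, e2, c⟩ := typeTwo_spec hK hcs hd (by simp) (by simp) hs
    simp only [List.map_nil, List.sum_nil, labelsList_nil, List.count_nil, List.length_nil,
      Nat.zero_add] at c
    refine ⟨?_, c⟩
    rw [walk_heavy (by rw [size_node, c.size]; simpa using h), e2, if_pos h2, e1]
  rw [if_neg h2] at hw
  obtain ⟨n, k, d, hH, hsz, hc, h0, hn, hk⟩ := children_spec hcs (by omega)
  generalize (cs.map (walk K)).flatMap Branch.hang = H at hw hH h0
  have hlen : ((cs.map (walk K)).map Branch.tree).length = cs.length := by simp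
  generalize (cs.map (walk K)).map Branch.tree = ts at hw hH hsz hc h0 hn hk hlen
  have hcs0 : ts ≠ [] := by
    rintro rfl
    have : cs = [] := List.length_eq_zero_iff.1 hlen.symm
    subst this
    simp at h
    omega
  -- the join of similar trees is read by the walk like the original tree
  have main : ∀ D', Sim T L D' (packed K ts H) → ∃ ts' X, D' = packed K ts' X ∧
      walk K (node false (glueForest D')) =
        (if K ≤ 1 + (ts.map size).sum then ⟨true, node Mark.new [], D'⟩
        else ⟨true, node Mark.plain ts', X⟩) ∧
      Counts T (glueForest D') (cs.map size).sum ((labelsList cs).count true) cs.length := by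
    intro D' hs
    obtain ⟨ts', X, e, es, r, x, c⟩ := packed_spec hK hsz hH hs
    refine ⟨ts', X, e, ?_, c.congr hn.symm hk hlen⟩
    rw [walk_heavy (by rw [size_node, c.size, ← hn]; simpa using h), r.heavy, hc, if_neg h2,
      r.trees, r.hang, es, ← e]
  by_cases hcut : K ≤ 1 + (ts.map size).sum
  · rw [if_pos hcut] at hw
    refine cutCase _ hw (packed_ne_nil hK hcs0 _) fun D' hs => ?_
    obtain ⟨ts', X, -, e, c⟩ := main D' hs
    exact ⟨by rw [e, if_pos hcut], c⟩
  · rw [if_neg hcut] at hw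
    -- a heavy node that is not cut has a heavy child
    have hpos : (labelsList ts).count Mark.new = 1 := by
      by_contra hne
      have z : (labelsList ts).count Mark.new = 0 := by have := hH.1; omega
      rw [z] at hn
      rw [size_node] at h
      omega
    obtain ⟨hH1, hH2, hH3⟩ := hH.2 (by omega)
    have ec : (walk K (node m cs)).cut K = packed K ts H := by
      rw [hw]; simp [Branch.cut, label, children]
    simp only [ec]
    refine ⟨⟨packed_ne_nil hK hcs0 _, fun D' hs => ?_⟩, fun _ => ?_⟩
    · obtain ⟨ts', X, e1, e, c⟩ := main D' hs
      rw [if_neg hcut] at e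
      rw [e]
      refine ⟨rfl, ?_, c⟩
      simp [Branch.cut, label, children, e1]
    · rw [hw]
      refine ⟨hH1, by rw [size_node]; omega, by simpa using hpos, n, k, d, hH2, hH3, ?_, ?_⟩
      · rw [hpos] at hn
        simp only [size_node]
        omega
      · rw [hpos] at hk
        simp only [labels_node, List.count_cons]
        simp
        omega

theorem childSpec (hK : 2 ≤ K) (t : MTree) (ht : ∀ s ∈ t.subtrees, s.degree ∈ degSet T) :
    ChildSpec T L K t := by
  induction t using induct with
  | h m cs ih =>
    simp only [subtrees, List.mem_cons, forall_eq_or_imp, mem_subtreesList] at ht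
    by_cases h : K ≤ (node m cs).size
    · exact (node_spec hK (fun c hc => ih c hc fun s hs => ht.2 s ⟨c, hc, hs⟩)
        (fun c hc => ht.2 c ⟨c, hc, self_mem_subtrees c⟩) h).2 ht.1
    · exact ⟨fun h' => absurd h' h, fun h' => absurd h' h⟩

/-- The decomposition of a tree of the family is recovered from the join of any trees with the same
parameters as its pieces. -/
theorem rebuilds_decomposition (hK : 2 ≤ K) {t : MTree} (hKt : K ≤ t.size)
    (ht : ∀ s ∈ t.properSubtrees, s.degree ∈ degSet T) :
    Rebuilds T L K ((walk K t).cut K) (t.children.map size).sum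
      ((labelsList t.children).count true) t.degree := by
  obtain ⟨m, cs⟩ := t
  simp only [properSubtrees, children, mem_subtreesList] at ht
  exact (node_spec hK (fun c hc => childSpec hK c fun s hs => ht s ⟨c, hc, hs⟩)
    (fun c hc => ht c ⟨c, hc, self_mem_subtrees c⟩) hKt).1.2

/-! ### Joining and decomposing trees of the family -/

theorem eq_none_of_f_eq {o : Obj} (h : f T L o = f T L none) : o = none := by
  cases o with
  | none => rfl
  | some t =>
    have := congrArg Params.size h
    have := size_pos t
    simp only [f] at *
    omega

/-- `S 0, S 1, …`, followed by empty trees. -/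
def padded {B : ℕ} (S : Fin B → Obj) (j : ℕ) : Obj := if hj : j < B then S ⟨j, hj⟩ else none

/-- Joining along the balanced parenthesis string of a decomposition tree is gluing the forest of
that shape whose nodes carry the given trees in preorder. -/
theorem join_bp {B : ℕ} (S : Fin B → Obj) (D : DTree) :
    join D.bp S = some (node false
      (glueForest ((numberList 0 D.children).map (RTree.map (padded S))))) := by
  have h : ∃ t : OrdTree, t.bp = D.bp := ⟨D.map fun _ => (), bp_map _ _⟩
  have hc : h.choose = D.map fun _ => () := bp_injective (h.choose_spec.trans (bp_map _ _).symm)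
  rw [join, dif_pos h, glueList_eq_glueForest, hc]
  obtain ⟨o, ds⟩ := D
  simp only [map_node, children, numberList_map]
  rfl

/-- A join with the same statistics as a tree of the family is in the family. -/
theorem mem_family_join {t : MTree} (ht : some t ∈ family T L) {ks : List MTree}
    (h : Counts T ks (t.children.map size).sum ((labelsList t.children).count true) t.degree) :
    some (node false ks) ∈ family T L := by
  obtain ⟨m, cs⟩ := t
  obtain ⟨h1, -, h3, -⟩ := ht _ rfl
  rintro _ ⟨⟩
  simp only [children] at h
  refine ⟨by simpa [h.size] using h1, fun s hs => (h.good s hs).2, ?_, rfl, ?_⟩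
  · have := h.marks
    simp only [labels_node, List.count_cons] at h3 ⊢
    simp
    omega
  · simp only [subtrees, List.mem_cons, forall_eq_or_imp, label]
    refine ⟨by simp, fun s hs hl => ?_⟩
    exact List.length_eq_zero_iff.1 ((h.good s hs).1 hl)

/-- If every forest similar to the decomposition of `t` is recovered from its join, then every
admissible choice of trees with the parameters of the pieces of `t` is. -/
theorem decompose_join {B : ℕ} {ℓ : ℕ → ℕ} {t : MTree} (ht : some t ∈ family T L)
    (hB : (pieces (ℓ t.size) t).length ≤ B)
    (hr : ∀ D', Sim T L D' ((walk (ℓ t.size) t).cut (ℓ t.size)) →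
      (walk (ℓ t.size) (node false (glueForest D'))).cut (ℓ t.size) = D' ∧
      Counts T (glueForest D') (t.children.map size).sum ((labelsList t.children).count true)
        t.degree)
    {S : Fin B → Obj} (hS : ∀ i, S i ∈ family T L)
    (hf : ∀ i : Fin B, f T L (S i) = f T L ((pieces (ℓ t.size) t).getD i none)) :
    join (decompTree (ℓ t.size) t).bp S ∈ family T L ∧
      decompose B ℓ (join (decompTree (ℓ t.size) t).bp S)
        = ((decompTree (ℓ t.size) t).bp, S) := by
  rw [join_bp]
  have hp : pieces (ℓ t.size) t = labelsList ((walk (ℓ t.size) t).cut (ℓ t.size)) := by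
    simp [pieces, decompTree]
  have hD : decompTree (ℓ t.size) t = node none ((walk (ℓ t.size) t).cut (ℓ t.size)) := rfl
  have hsize : t.size = 1 + (t.children.map size).sum := by
    cases t; simp [children]
  rw [hp] at hB hf
  rw [hD]
  generalize (walk (ℓ t.size) t).cut (ℓ t.size) = ds at *
  simp only [children]
  have hlab : labelsList ((numberList 0 ds).map (RTree.map (padded S)))
      = (List.range (labelsList ds).length).map (padded S) := by
    rw [labelsList_map, labelsList_numberList, List.range_eq_range', labelsList, List.length_map,
      length_subtreesList]
  have hsim : Sim T L ((numberList 0 ds).map (RTree.map (padded S))) ds := by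
    constructor
    · rw [List.map_map, ← map_numberList (fun j => f T L (padded S j)) (f T L) ds 0]
      · simp only [List.map_inj_left, Function.comp, RTree.map_map, implies_true]
      · intro i hi
        rw [Nat.zero_add, padded, dif_pos (hi.trans_le hB), hf]
        simp [hi]
    · rw [hlab]
      simp only [List.mem_map, forall_exists_index, and_imp]
      rintro _ j _ rfl
      unfold padded
      split_ifs
      · exact hS _
      · exact fun _ h => by simp at h
  generalize (numberList 0 ds).map (RTree.map (padded S)) = D' at hsim hlab
  obtain ⟨h1, h2⟩ := hr D' hsim
  refine ⟨mem_family_join ht h2, ?_⟩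
  have hsz : (node false (glueForest D')).size = t.size := by
    rw [size_node, h2.size, hsize]
  simp only [decompose, hsz, pieces, decompTree, h1, labels_node, List.tail_cons, hlab,
    Prod.mk.injEq]
  constructor
  · rw [← bp_map (f T L) (node none D'), ← bp_map (f T L) (node none ds), map_node, map_node,
      hsim.1]
  · funext i
    by_cases hi : (i : ℕ) < (labelsList ds).length
    · simp [hi, padded]
    · have := hf i
      rw [List.getD_eq_default _ _ (by omega)] at this
      rw [List.getD_eq_default _ _ (by simpa using hi), eq_none_of_f_eq this]

theorem cut_walk_leaf (K : ℕ) : (walk K (node false [])).cut K = [] := by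
  by_cases h : (node false []).size < K
  · rw [walk_light h]
    simp [Branch.cut, label, oldMark, children, packed, pack]
  · rw [walk_heavy (by omega)]
    simp at h
    simp [Branch.cut, label, packed, pack, h]

end TreeRep

theorem mainTheorem4 (T : TreeRep.OrdTree) (B L : ℕ) (hB : 0 < B) (hL : 0 < L)
    (ℓ : ℕ → ℕ)
    (hℓ : ∀ m, 2 ≤ m → m ≤ 2 * L + 1 → 2 ≤ ℓ m ∧ ℓ m ≤ m)
    (hcount : ∀ A : TreeRep.MTree, some A ∈ TreeRep.family T L →
      (TreeRep.pieces (ℓ A.size) A).length ≤ B)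
    (β : List DyckStep) (S : Fin B → TreeRep.Obj)
    (hS : ∀ i, S i ∈ TreeRep.family T L)
    (hF : (β, fun i => TreeRep.f T L (S i)) ∈ TreeRep.tuples T B L ℓ) :
    TreeRep.join β S ∈ TreeRep.family T L ∧
      TreeRep.decompose B ℓ (TreeRep.join β S) = (β, S) := by
  obtain ⟨A, hA, hx⟩ := hF
  obtain ⟨rfl, hf⟩ := Prod.mk.inj hx
  cases A with
  | none =>
    have hj : TreeRep.join [] S = none := by
      rw [TreeRep.join, dif_neg]
      rintro ⟨⟨_, _⟩, h⟩
      simp [TreeRep.RTree.bp] at h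
    simp only [TreeRep.decompose, hj]
    refine ⟨hA, ?_⟩
    congr 1
    funext i
    exact (TreeRep.eq_none_of_f_eq (congrFun hf i)).symm
  | some t =>
    obtain ⟨h1, h2, -, h4, -⟩ := hA t rfl
    refine TreeRep.decompose_join hA (hcount t hA) (fun D' hD' => ?_) hS (congrFun hf)
    by_cases h : 2 ≤ t.size
    · obtain ⟨l1, l2⟩ := hℓ _ h h1
      exact (TreeRep.rebuilds_decomposition l1 l2 h2 D' hD').2
    · -- a tree with a single node has an empty decomposition, whatever the parameter is
      obtain ⟨m, cs⟩ := t
      cases h4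
      have hcs : cs = [] := by
        cases cs with
        | nil => rfl
        | cons c cs =>
          have := c.size_pos
          simp at h
          omega
      subst hcs
      rw [TreeRep.cut_walk_leaf] at hD'
      cases hD'.eq_nil
      exact ⟨TreeRep.cut_walk_leaf _, TreeRep.Counts.nil⟩
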